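/- A permutation of order $n$ (an $n$-permutation) is a bijection of $[n]=\{1,\dots,n\}$ with itself; $|\pi|$ denotes the order of $\pi$. For $a_1<\dots<a_k$ in $[n]$, the set $\{a_1,\dots,a_k\}$ induces in an $n$-permutation $\Pi$ the $k$-permutation $\pi$ with $\pi(i)<\pi(j)\iff\Pi(a_i)<\Pi(a_j)$, and $d(\pi,\Pi)$ is the proportion of the $|\pi|$-element subsets of $[n]$ that induce $\pi$ (it is $0$ if $|\pi|>n$). A set $S$ of permutations is forcing if every sequence $(\Pi_i)$ of permutations with $|\Pi_i|\to\infty$ and $d(\pi,\Pi_i)\to 1/|\pi|!$ for all $\pi\in S$ satisfies $d(\pi,\Pi_i)\to 1/|\pi|!$ for all permutations $\pi$. For a non-negative $n\times n$ matrix $M$ all of whose rows and columns sum to $1$, let $\mu[M]$ be the Borel probability measure on $[0,1]^2$ with density $nM_{i,j}$ on $[\frac{i-1}n,\frac in]\times[\frac{j-1}n,\frac jn]$, and let $d(\pi,\mu[M])$ be the probability that $k=|\pi|$ independent $\mu[M]$-random points, listed as $(x_1,y_1),\dots,(x_k,y_k)$ with $x_1<\dots<x_k$, satisfy $\pi(i)<\pi(j)\iff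 y_i<y_j$ for all $i,j$. For $n>1$ and $k,l\in[n-1]$ let $B^{k,l}$ be the $n\times n$ matrix with entries $1$ at $(k,l)$ and $(k+1,l+1)$, $-1$ at $(k+1,l)$ and $(k,l+1)$, and $0$ elsewhere. For $x\in\mathbb R^{(n-1)\times(n-1)}$ close to $0$ let $C^x$ be the matrix $\frac1n J+\sum_{k,l}x_{k,l}B^{k,l}$, where $J$ is the all-ones matrix, and let $h_{\pi,n}(x)=d(\pi,\mu[C^x])$. The gradient polynomial of $\pi$ is the unique real polynomial $P_\pi$ in two variables such that $$P_\pi(\alpha,\beta)=\lim_{n\to\infty}n^3\,\frac{\partial h_{\pi,n}}{\partial x_{\lfloor\alpha n\rfloor,\lfloor\beta n\rfloor}}(0)\qquad\text{for all }\alpha,\beta\in(0,1).$$ Let $S$ be a non-empty finite set of permutations. Then the gradient polynomial $P_\pi$ of each $\pi\in S$ is well defined (there is exactly one polynomial with this property), and if the family $(P_\pi)_{\pi\in S}$ is linearly independent over $\mathbb R$, then $S$ is not forcing. -/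

import Mathlib

namespace PermForcing

open MeasureTheory Filter Topology

/-- A permutation of arbitrary finite order: the pair of its order `n` and a bijection of an
`n`-element ordered set (here `{0, …, n-1}`) with itself. -/
abbrev Permutation : Type := Σ n : ℕ, Equiv.Perm (Fin n)

open Classical in
/-- The density `d(π, Π)`: the proportion of the `|π|`-element subsets `A` of the domain of `Π` that
induce `π`. It is `0` if `|π| > |Π|`, since then there is no such subset. -/
noncomputable def patternDensity (π Q : Permutation) : ℝ :=
  ((((Finset.univ : Finset (Fin Q.1)).powersetCard π.1).filter (fun A =>
      ∃ h : A.card = π.1, ∀ i j : Fin π.1,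
        π.2 i < π.2 j ↔ Q.2 (A.orderEmbOfFin h i) < Q.2 (A.orderEmbOfFin h j))).card : ℝ)
    / (Q.1.choose π.1 : ℝ)

/-- The density of `π` along the sequence `Q` tends to `1 / |π|!`. -/
def HasUniformLimitDensity (Q : ℕ → Permutation) (π : Permutation) : Prop :=
  Tendsto (fun i => patternDensity π (Q i)) atTop (𝓝 (1 / (π.1.factorial : ℝ)))

/-- A sequence of permutations is quasirandom if every pattern has the limit density that it has in
a uniformly random permutation. -/
def IsQuasirandom (Q : ℕ → Permutation) : Prop :=
  ∀ π : Permutation, HasUniformLimitDensity Q π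

/-- A set `S` of permutations is forcing if every sequence of permutations, of orders tending to
infinity, in which the patterns of `S` have the right limit densities is quasirandom.
(Without the condition on the orders fewer sets would be forcing, so not being forcing in the
present sense implies not being forcing in that sense.) -/
def IsForcing (S : Set Permutation) : Prop :=
  ∀ Q : ℕ → Permutation, Tendsto (fun i => (Q i).1) atTop atTop →
    (∀ π ∈ S, HasUniformLimitDensity Q π) → IsQuasirandom Q

/-- The points `p 0, …, p (k-1)` of the plane (in any order) have distinct first coordinates and,
listed by increasing first coordinate, induce the permutation `π`. -/
def Induces {k : ℕ} (p : Fin k → ℝ × ℝ) (π : Equiv.Perm (Fin k)) : Prop :=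
  ∃ σ : Equiv.Perm (Fin k), StrictMono (fun i => (p (σ i)).1) ∧
    ∀ i j : Fin k, π i < π j ↔ (p (σ i)).2 < (p (σ j)).2

/-- The density `d(π, μ)`: the probability that `|π|` independent `μ`-random points induce `π`. -/
noncomputable def permutonDensity (π : Permutation) (μ : Measure (ℝ × ℝ)) : ℝ :=
  (Measure.pi (fun _ : Fin π.1 => μ)).real {p | Induces p π.2}

/-- The measure `μ[M]` whose density on the tile `[i/n, (i+1)/n] × [j/n, (j+1)/n]`, `0 ≤ i, j < n`,
is `n * M i j`. It is a permuton if `M` is doubly stochastic. -/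
noncomputable def stepPermuton {n : ℕ} (M : Matrix (Fin n) (Fin n) ℝ) : Measure (ℝ × ℝ) :=
  ∑ i : Fin n, ∑ j : Fin n, ENNReal.ofReal (n * M i j) •
    (volume : Measure (ℝ × ℝ)).restrict
      (Set.Icc ((i : ℝ) / n) (((i : ℝ) + 1) / n) ×ˢ Set.Icc ((j : ℝ) / n) (((j : ℝ) + 1) / n))

/-- The constant doubly stochastic matrix of order `n`. -/
noncomputable def constMatrix (n : ℕ) : Matrix (Fin n) (Fin n) ℝ :=
  Matrix.of fun _ _ => 1 / (n : ℝ)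

/-- The matrix `B^{k,l}` of order `n`, with rows and columns indexed from `0`. -/
def perturbation (n : ℕ) (k l : Fin (n - 1)) : Matrix (Fin n) (Fin n) ℝ :=
  Matrix.of fun i j =>
    if (i.val = k.val ∧ j.val = l.val) ∨ (i.val = k.val + 1 ∧ j.val = l.val + 1) then 1
    else if (i.val = k.val + 1 ∧ j.val = l.val) ∨ (i.val = k.val ∧ j.val = l.val + 1) then -1
    else 0

/-- The constant matrix of order `n` perturbed by `∑ x k l * B^{k,l}`. -/
noncomputable def perturbedMatrix (n : ℕ) (x : Matrix (Fin (n - 1)) (Fin (n - 1)) ℝ) :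
    Matrix (Fin n) (Fin n) ℝ :=
  constMatrix n + ∑ k : Fin (n - 1), ∑ l : Fin (n - 1), x k l • perturbation n k l

/-- The density function `h_{π,n}`. -/
noncomputable def densityFunction (π : Permutation) (n : ℕ)
    (x : Matrix (Fin (n - 1)) (Fin (n - 1)) ℝ) : ℝ :=
  permutonDensity π (stepPermuton (perturbedMatrix n x))

/-- The unit vector of the coordinate `x_{a,b}`, where `a` and `b` count rows and columns from `1`
(it is zero if `a` or `b` is outside `{1, …, n-1}`). -/
def unitMatrix (n a b : ℕ) : Matrix (Fin (n - 1)) (Fin (n - 1)) ℝ :=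
  Matrix.of fun i j => if i.val + 1 = a ∧ j.val + 1 = b then 1 else 0

/-- The partial derivative of `h_{π,n}` at the origin with respect to `x_{a,b}`, `1 ≤ a, b < n`. -/
noncomputable def densityPartial (π : Permutation) (n a b : ℕ) : ℝ :=
  lineDeriv ℝ (densityFunction π n) 0 (unitMatrix n a b)

/-- The polynomial `P` in the two variables `α, β` has the property that defines the gradient
polynomial of `π`. -/
def IsGradientPolynomial (π : Permutation) (P : MvPolynomial (Fin 2) ℝ) : Prop :=
  ∀ α ∈ Set.Ioo (0 : ℝ) 1, ∀ β ∈ Set.Ioo (0 : ℝ) 1,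
    Tendsto (fun n : ℕ => (n : ℝ) ^ 3 * densityPartial π n ⌊α * n⌋₊ ⌊β * n⌋₊) atTop
      (𝓝 (MvPolynomial.eval ![α, β] P))

open Classical in
/-- The gradient polynomial `P_π`: the polynomial with the property `IsGradientPolynomial π`
(the value `0` is only a default in case that there is none). -/
noncomputable def gradientPolynomial (π : Permutation) : MvPolynomial (Fin 2) ℝ :=
  if h : ∃ P, IsGradientPolynomial π P then h.choose else 0

end PermForcing

/-!
The density of a pattern `π` of order `k` in a step permuton is a polynomial in the entries of the
matrix. Its derivative at the constant matrix, in the direction of a matrix of rank one, splits into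
a horizontal and a vertical factor (`sum_tileWeight_mul_rankOne`): once the order in which the
points are listed is fixed, both coordinates of the points just have to be sorted. Each factor is a
difference of values of the distribution function of an order statistic of `k` uniform points, which
is a polynomial (`measureReal_strictMono_le`). As `B^{k,l}` is a product of two difference vectors,
second-order differences of these polynomials appear, and in the limit their second derivatives:
the gradient polynomial is `k! * ∑ i, H_i''(α) * H_{π i}''(β)`
(`isGradientPolynomial_explicitGradient`).

On the diagonal `α = β`, the gradient polynomial of the identity of order `k` is a sum of squares of
degree `2(k-2)`. Hence the gradient polynomials of a finite set `S` never span all gradient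
polynomials, and if they are linearly independent, then they remain so when the gradient polynomial
of a suitable identity permutation `π₀` is added (`exists_explicitGradient_notMem_span`). Linearly
independent polynomials have linearly independent vectors of values at suitable points of the unit
square, and therefore, for large `n`, the vector of the densities of `π ∈ S ∪ {π₀}` has a surjective
derivative at the constant matrix. A map with a surjective derivative is open there, so some step
permuton gives every `π ∈ S` the density `1 / |π|!` and gives `π₀` a density other than `1 / |π₀|!`
(`exists_matrix_density_ne`).

Finally, the permutation induced by `N` independent points of this permuton has pattern densities
whose expectations are the densities in the permuton and whose variances tend to `0`, because
disjoint sets of points behave independently (`integral_sampleDensity_sub_sq_le`). A suitable sample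
for each `N` gives a sequence in which the densities of `S` have the uniform limits while that of
`π₀` has a different limit.
-/

namespace PermForcing

open MeasureTheory ProbabilityTheory Filter Topology
open scoped ENNReal

/-! ### Finite products of measures -/

lemma pi_finsetSum {ι κ Ω : Type*} [Fintype ι] [DecidableEq ι] [MeasurableSpace Ω]
    (A : ι → Finset κ) (μ : ι → κ → Measure Ω) [∀ i t, IsFiniteMeasure (μ i t)] :
    Measure.pi (fun i => ∑ t ∈ A i, μ i t) =
      ∑ c ∈ Fintype.piFinset A, Measure.pi (fun i => μ i (c i)) := by
  apply Measure.pi_eq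
  intro s hs
  simp only [Measure.finsetSum_apply, Measure.pi_pi]
  exact (Finset.prod_univ_sum A fun i t => μ i t (s i)).symm

lemma pi_smul_measure {ι Ω : Type*} [Fintype ι] [MeasurableSpace Ω] (w : ι → ℝ≥0∞)
    (hw : ∀ i, w i ≠ ∞) (μ : ι → Measure Ω) [∀ i, IsFiniteMeasure (μ i)] :
    Measure.pi (fun i => w i • μ i) = (∏ i, w i) • Measure.pi μ := by
  have : ∀ i, IsFiniteMeasure (w i • μ i) := fun i => Measure.smul_finite _ (hw i)
  apply Measure.pi_eq
  intro s hs
  simp [Measure.pi_pi, Finset.prod_mul_distrib]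

lemma measurePreserving_comp_injective {ι κ Ω : Type*} [Fintype ι] [Fintype κ]
    [MeasurableSpace Ω] (μ : Measure Ω) [IsProbabilityMeasure μ] {e : κ → ι}
    (he : Function.Injective e) :
    MeasurePreserving (fun p : ι → Ω => fun m => p (e m)) (Measure.pi fun _ : ι => μ)
      (Measure.pi fun _ : κ => μ) := by
  refine ⟨by fun_prop, ?_⟩
  have h1 : iIndepFun (fun (i : ι) (ω : ι → Ω) => ω i) (Measure.pi fun _ : ι => μ) :=
    iIndepFun_pi (X := fun _ x => x) (fun _ => aemeasurable_id)
  have h2 := h1.precomp he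
  rw [iIndepFun_iff_map_fun_eq_pi_map (fun i => (measurable_pi_apply (e i)).aemeasurable)] at h2
  rw [h2]
  congr 1
  funext m
  exact (measurePreserving_eval (fun _ : ι => μ) (e m)).map_eq

lemma ae_injective_comp {ι Ω : Type*} [Fintype ι] [MeasurableSpace Ω] (μ : Measure Ω)
    [IsProbabilityMeasure μ] {f : Ω → ℝ} (hf : Measurable f) (h : ∀ a, μ {ω | f ω = a} = 0) :
    ∀ᵐ p ∂Measure.pi (fun _ : ι => μ), Function.Injective (fun i => f (p i)) := by
  have key : ∀ i j : ι, i ≠ j → ∀ᵐ p ∂Measure.pi (fun _ : ι => μ), f (p i) ≠ f (p j) := by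
    intro i j hij
    have h1 : iIndepFun (fun (i : ι) (ω : ι → Ω) => ω i) (Measure.pi fun _ : ι => μ) :=
      iIndepFun_pi (X := fun _ x => x) (fun _ => aemeasurable_id)
    have h2 := h1.indepFun hij
    rw [indepFun_iff_map_prod_eq_prod_map_map (measurable_pi_apply i).aemeasurable
      (measurable_pi_apply j).aemeasurable] at h2
    have h3 : ∀ i : ι, Measure.map (fun ω : ι → Ω => ω i) (Measure.pi fun _ : ι => μ) = μ :=
      fun i => (measurePreserving_eval (fun _ : ι => μ) i).map_eq
    rw [h3, h3] at h2
    have hm : MeasurableSet {q : Ω × Ω | f q.1 = f q.2} :=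
      measurableSet_eq_fun (by fun_prop) (by fun_prop)
    have h4 : (μ.prod μ) {q : Ω × Ω | f q.1 = f q.2} = 0 := by
      rw [Measure.measure_prod_null hm]
      refine Eventually.of_forall fun x => ?_
      have : Prod.mk x ⁻¹' {q : Ω × Ω | f q.1 = f q.2} = {ω | f ω = f x} := by
        ext; simp [eq_comm]
      simpa [this] using h (f x)
    rw [← h2, Measure.map_apply (by fun_prop) hm] at h4
    rw [ae_iff]
    simpa using h4
  have : ∀ᵐ p ∂Measure.pi (fun _ : ι => μ), ∀ i j, i ≠ j → f (p i) ≠ f (p j) := by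
    rw [ae_all_iff]; intro i
    rw [ae_all_iff]; intro j
    by_cases hij : i = j
    · simp [hij]
    · simpa [hij] using key i j hij
  filter_upwards [this] with p hp i j hij
  by_contra hne
  exact hp i j hne hij

/-! ### Sorting -/

lemma exists_strictMono_comp_perm {k : ℕ} {u : Fin k → ℝ} (hu : Function.Injective u) :
    ∃ σ : Equiv.Perm (Fin k), StrictMono (fun i => u (σ i)) :=
  ⟨Tuple.sort u, (Tuple.monotone_sort u).strictMono_of_injective
    (hu.comp (Tuple.sort u).injective)⟩

lemma perm_eq_of_strictMono {k : ℕ} {u : Fin k → ℝ} {σ τ : Equiv.Perm (Fin k)}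
    (hσ : StrictMono (fun i => u (σ i))) (hτ : StrictMono (fun i => u (τ i))) : σ = τ := by
  have hr : ∀ ρ : Equiv.Perm (Fin k), Set.range (fun i => u (ρ i)) = Set.range u := fun ρ =>
    ρ.surjective.range_comp u
  have h := (hσ.range_inj hτ).1 ((hr σ).trans (hr τ).symm)
  have hu : Function.Injective u := by
    intro a b hab
    have := hσ.injective (a₁ := σ.symm a) (a₂ := σ.symm b) (by simpa using hab)
    simpa using this
  ext1 i
  exact hu (congrFun h i)

lemma measurableSet_strictMono_comp {k l : ℕ} (e : Fin l → Fin k) :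
    MeasurableSet {u : Fin k → ℝ | StrictMono (fun i => u (e i))} := by
  have : {u : Fin k → ℝ | StrictMono (fun i => u (e i))} =
      ⋂ (i : Fin l) (j : Fin l) (_ : i < j), {u | u (e i) < u (e j)} := by
    ext u; simp [StrictMono]
  rw [this]
  exact MeasurableSet.iInter fun i => MeasurableSet.iInter fun j => MeasurableSet.iInter fun _ =>
    measurableSet_lt (by fun_prop) (by fun_prop)

lemma induces_iff {k : ℕ} {p : Fin k → ℝ × ℝ} {π : Equiv.Perm (Fin k)} :
    Induces p π ↔ ∃ σ : Equiv.Perm (Fin k), StrictMono (fun i => (p (σ i)).1) ∧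
      StrictMono (fun i => (p (σ (π.symm i))).2) := by
  unfold Induces
  refine exists_congr fun σ => and_congr_right fun _ => ?_
  constructor
  · intro h i j hij
    exact (h _ _).1 (by simpa using hij)
  · intro h i j
    simpa using (h.lt_iff_lt (a := π i) (b := π j)).symm

lemma measurableSet_induces {k : ℕ} (π : Equiv.Perm (Fin k)) :
    MeasurableSet {p : Fin k → ℝ × ℝ | Induces p π} := by
  simp only [induces_iff, Set.ofPred_exists]
  refine MeasurableSet.iUnion fun σ => MeasurableSet.inter ?_ ?_
  · exact (measurableSet_strictMono_comp (fun i => σ i)).preimage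
      (f := fun (p : Fin k → ℝ × ℝ) i => (p i).1) (by fun_prop)
  · exact (measurableSet_strictMono_comp (fun i => σ (π.symm i))).preimage
      (f := fun (p : Fin k → ℝ × ℝ) i => (p i).2) (by fun_prop)

/-- Of a permutation-invariant event for independent points of the line, one part in `k!` consists
of the configurations whose coordinates are increasing. -/
lemma factorial_mul_measureReal_inter_strictMono {k : ℕ} (ν : Measure ℝ) [IsProbabilityMeasure ν]
    (hν : ∀ a, ν {a} = 0) {E : Set (Fin k → ℝ)} (hE : MeasurableSet E)
    (hsymm : ∀ (σ : Equiv.Perm (Fin k)) (u : Fin k → ℝ), u ∈ E → (fun i => u (σ i)) ∈ E) :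
    (k.factorial : ℝ) * (Measure.pi fun _ : Fin k => ν).real (E ∩ {u | StrictMono u}) =
      (Measure.pi fun _ : Fin k => ν).real E := by
  set P := Measure.pi fun _ : Fin k => ν with hP
  have hinj := ae_injective_comp (ι := Fin k) ν (f := id) measurable_id (by simpa using hν)
  have h1 : P.real E =
      P.real (⋃ σ : Equiv.Perm (Fin k), E ∩ {u | StrictMono (fun i => u (σ i))}) := by
    apply measureReal_congr
    filter_upwards [hinj] with u hu
    apply propext
    change u ∈ E ↔ u ∈ ⋃ σ : Equiv.Perm (Fin k), E ∩ {u | StrictMono (fun i => u (σ i))}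
    simp only [Set.mem_iUnion]
    constructor
    · intro h
      obtain ⟨σ, hσ⟩ := exists_strictMono_comp_perm (u := u) hu
      exact ⟨σ, h, hσ⟩
    · rintro ⟨σ, h, -⟩
      exact h
  have h2 : ∀ σ : Equiv.Perm (Fin k), P.real (E ∩ {u | StrictMono (fun i => u (σ i))}) =
      P.real (E ∩ {u | StrictMono u}) := by
    intro σ
    have hmp := measurePreserving_comp_injective (ι := Fin k) ν σ.injective
    have hm : MeasurableSet (E ∩ {u : Fin k → ℝ | StrictMono u}) :=
      hE.inter (measurableSet_strictMono_comp (fun i => i))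
    rw [← hmp.measureReal_preimage hm.nullMeasurableSet]
    congr 1
    ext u
    simp only [Set.mem_inter_iff, Set.mem_ofPred_eq, Set.mem_preimage]
    refine and_congr_left fun _ => ⟨hsymm σ u, fun h => ?_⟩
    simpa using hsymm σ.symm _ h
  rw [h1, measureReal_iUnion_fintype]
  · simp [h2, Fintype.card_perm]
  · intro σ τ hst
    refine Set.disjoint_left.2 ?_
    rintro u ⟨-, hu⟩ ⟨-, hu'⟩
    exact hst (perm_eq_of_strictMono hu hu')
  · exact fun σ => hE.inter (measurableSet_strictMono_comp (fun i => σ i))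

/-! ### Order statistics of uniform points -/

/-- Lebesgue measure on the unit interval, taken half-open so that half-open cells add up to it. -/
noncomputable def unitMeasure : Measure ℝ := volume.restrict (Set.Ioc 0 1)

instance : IsProbabilityMeasure unitMeasure := ⟨by simp [unitMeasure]⟩

lemma unitMeasure_singleton (a : ℝ) : unitMeasure {a} = 0 := by
  simp [unitMeasure]

lemma unitMeasure_real_Iic {c : ℝ} (h0 : 0 ≤ c) (h1 : c ≤ 1) :
    unitMeasure.real (Set.Iic c) = c := by
  have : Set.Iic c ∩ Set.Ioc 0 1 = Set.Ioc 0 c := by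
    ext x; simp only [Set.mem_inter_iff, Set.mem_Iic, Set.mem_Ioc]; grind
  simp [unitMeasure, measureReal_restrict_apply, this, h0]

lemma unitMeasure_real_Ioi {c : ℝ} (h0 : 0 ≤ c) (h1 : c ≤ 1) :
    unitMeasure.real (Set.Ioi c) = 1 - c := by
  rw [← Set.compl_Iic, probReal_compl_eq_one_sub measurableSet_Iic, unitMeasure_real_Iic h0 h1]

open Polynomial in
/-- The polynomial whose value at `c ∈ [0, 1]` is the probability that `k` independent uniform
points are in increasing order and that the one with index `i` is at most `c`: a tail of the
binomial distribution, divided by `k!`. -/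
noncomputable def orderStatPoly (k : ℕ) (i : Fin k) : ℝ[X] :=
  C (1 / (k.factorial : ℝ)) *
    ∑ A ∈ (Finset.univ : Finset (Finset (Fin k))).filter (fun A => i.val < A.card),
      X ^ A.card * (1 - X) ^ (k - A.card)

open Classical in
lemma measureReal_filter_le_eq {k : ℕ} (A : Finset (Fin k)) {c : ℝ} (h0 : 0 ≤ c) (h1 : c ≤ 1) :
    (Measure.pi fun _ : Fin k => unitMeasure).real
      {u | (Finset.univ.filter fun m => u m ≤ c) = A} = c ^ A.card * (1 - c) ^ (k - A.card) := by
  have : {u : Fin k → ℝ | (Finset.univ.filter fun m => u m ≤ c) = A} =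
      Set.univ.pi fun m => if m ∈ A then Set.Iic c else Set.Ioi c := by
    ext u
    simp only [Set.mem_ofPred_eq, Set.mem_univ_pi, Finset.ext_iff, Finset.mem_filter,
      Finset.mem_univ, true_and]
    refine forall_congr' fun m => ?_
    split_ifs with hm <;> simp [hm]
  rw [this, measureReal_def, Measure.pi_pi, ENNReal.toReal_prod]
  have h2 : ∀ m : Fin k, (unitMeasure (if m ∈ A then Set.Iic c else Set.Ioi c)).toReal =
      if m ∈ A then c else 1 - c := by
    intro m
    split_ifs
    · exact unitMeasure_real_Iic h0 h1
    · exact unitMeasure_real_Ioi h0 h1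
  simp only [h2]
  rw [Finset.prod_ite]
  have h3 : (Finset.univ.filter fun m => m ∈ A) = A := by ext; simp
  have h4 : (Finset.univ.filter fun m => m ∉ A) = Aᶜ := by ext; simp
  simp [h3, h4, Finset.card_compl]

open Classical in
lemma measurableSet_filter_le_eq {k : ℕ} (A : Finset (Fin k)) (c : ℝ) :
    MeasurableSet {u : Fin k → ℝ | (Finset.univ.filter fun m => u m ≤ c) = A} := by
  have : {u : Fin k → ℝ | (Finset.univ.filter fun m => u m ≤ c) = A} =
      ⋂ m : Fin k, {u | u m ≤ c ↔ m ∈ A} := by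
    ext u; simp [Finset.ext_iff]
  rw [this]
  refine MeasurableSet.iInter fun m => ?_
  by_cases hm : m ∈ A
  · simpa [hm] using measurableSet_le (measurable_pi_apply m) measurable_const
  · simpa [hm] using measurableSet_lt measurable_const (measurable_pi_apply m)

open Classical in
lemma measureReal_strictMono_le {k : ℕ} (i : Fin k) {c : ℝ} (h0 : 0 ≤ c) (h1 : c ≤ 1) :
    (Measure.pi fun _ : Fin k => unitMeasure).real {u | StrictMono u ∧ u i ≤ c} =
      (orderStatPoly k i).eval c := by
  set P := Measure.pi fun _ : Fin k => unitMeasure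
  -- For increasing coordinates, `u i ≤ c` says that more than `i` coordinates are at most `c`;
  -- the latter event does not depend on the order of the coordinates.
  set E : Set (Fin k → ℝ) := ⋃ A ∈ (Finset.univ.filter fun A : Finset (Fin k) => i.val < A.card),
    {u | (Finset.univ.filter fun m => u m ≤ c) = A} with hEdef
  have hmem : ∀ u, u ∈ E ↔ i.val < (Finset.univ.filter fun m => u m ≤ c).card := by
    intro u; simp [hEdef]
  have hE : MeasurableSet E := Finset.measurableSet_biUnion _ fun A _ =>
    measurableSet_filter_le_eq A c
  have hPE : P.real E = ∑ A ∈ (Finset.univ.filter fun A : Finset (Fin k) => i.val < A.card),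
      c ^ A.card * (1 - c) ^ (k - A.card) := by
    rw [hEdef, measureReal_biUnion_finset]
    · exact Finset.sum_congr rfl fun A _ => measureReal_filter_le_eq A h0 h1
    · intro A _ B _ hAB
      refine Set.disjoint_left.2 fun u hu hu' => hAB ?_
      exact Eq.trans (Eq.symm hu) hu'
    · exact fun A _ => measurableSet_filter_le_eq A c
  have hsymm : ∀ (σ : Equiv.Perm (Fin k)) (u : Fin k → ℝ), u ∈ E → (fun i => u (σ i)) ∈ E := by
    intro σ u hu
    rw [hmem] at hu ⊢
    refine hu.trans_eq ?_
    refine Finset.card_bij (fun m _ => σ.symm m) ?_ ?_ ?_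
    · intro m; simp
    · intro m _ m' _ h; simpa using h
    · intro m hm; exact ⟨σ m, by simpa using hm, by simp⟩
  have hset : {u : Fin k → ℝ | StrictMono u ∧ u i ≤ c} = E ∩ {u | StrictMono u} := by
    ext u
    simp only [Set.mem_inter_iff, hmem, Set.mem_ofPred_eq]
    rw [and_comm]
    refine and_congr_left fun hu => ⟨fun h => ?_, fun h => ?_⟩
    · calc i.val < (Finset.Iic i).card := by simp
        _ ≤ _ := Finset.card_le_card fun m hm => by
          simpa using (hu.monotone (Finset.mem_Iic.1 hm)).trans h
    · by_contra hc
      have : (Finset.univ.filter fun m => u m ≤ c).card ≤ (Finset.Iio i).card := by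
        refine Finset.card_le_card fun m hm => ?_
        simp only [Finset.mem_filter, Finset.mem_univ, true_and] at hm
        exact Finset.mem_Iio.2 (hu.lt_iff_lt.1 (hm.trans_lt (not_le.1 hc)))
      simp at this
      omega
  have key := factorial_mul_measureReal_inter_strictMono unitMeasure unitMeasure_singleton hE hsymm
  have hk : (k.factorial : ℝ) ≠ 0 := by positivity
  rw [hset, orderStatPoly]
  simp only [Polynomial.eval_mul, Polynomial.eval_C, Polynomial.eval_finsetSum,
    Polynomial.eval_pow, Polynomial.eval_X, Polynomial.eval_sub, Polynomial.eval_one]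
  rw [← hPE, ← key]
  field_simp
  rfl

lemma measureReal_strictMono (k : ℕ) :
    (Measure.pi fun _ : Fin k => unitMeasure).real {u | StrictMono u} = 1 / (k.factorial : ℝ) := by
  have key := factorial_mul_measureReal_inter_strictMono (k := k) unitMeasure
    unitMeasure_singleton MeasurableSet.univ (fun _ _ _ => trivial)
  have hk : (k.factorial : ℝ) ≠ 0 := by positivity
  rw [Set.univ_inter, probReal_univ] at key
  field_simp
  linarith

lemma natDegree_orderStatPoly_le {k : ℕ} (i : Fin k) : (orderStatPoly k i).natDegree ≤ k := by
  refine (Polynomial.natDegree_C_mul_le _ _).trans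
    (Polynomial.natDegree_sum_le_of_forall_le _ _ fun A _ => ?_)
  have hA : A.card ≤ k := by simpa using Finset.card_le_univ A
  have h1 : (1 - Polynomial.X : Polynomial ℝ).natDegree ≤ 1 := by compute_degree
  calc _ ≤ A.card + (k - A.card) * 1 := Polynomial.natDegree_mul_le_of_le (by simp)
        (Polynomial.natDegree_pow_le_of_le _ h1)
    _ = k := by omega

/-- The largest order statistic is at most `c` with probability `c ^ k`. -/
lemma orderStatPoly_last {k : ℕ} (i : Fin k) (hi : i.val + 1 = k) :
    orderStatPoly k i = Polynomial.C (1 / (k.factorial : ℝ)) * Polynomial.X ^ k := by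
  have : (Finset.univ : Finset (Finset (Fin k))).filter (fun A => i.val < A.card) =
      {Finset.univ} := by
    ext A
    simp only [Finset.mem_filter, Finset.mem_univ, true_and, Finset.mem_singleton]
    have h2 := Finset.card_eq_iff_eq_univ A
    have h3 := Finset.card_le_univ A
    rw [Fintype.card_fin] at h2 h3
    rw [← h2]
    omega
  simp [orderStatPoly, this]

/-- The second symmetric difference quotients of a polynomial converge to its second derivative,
even at a moving point. -/
lemma tendsto_second_difference (p : Polynomial ℝ) {x h : ℕ → ℝ} {a : ℝ}
    (hx : Tendsto x atTop (𝓝 a)) (hh : Tendsto h atTop (𝓝 0)) (h0 : ∀ᶠ n in atTop, h n ≠ 0) :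
    Tendsto (fun n => (p.eval (x n + h n) - 2 * p.eval (x n) + p.eval (x n - h n)) / h n ^ 2)
      atTop (𝓝 (p.derivative.derivative.eval a)) := by
  have hp : ∀ q : Polynomial ℝ, Tendsto (fun n => q.eval (x n + h n)) atTop (𝓝 (q.eval a)) := by
    intro q
    have := hx.add hh
    rw [add_zero] at this
    exact (q.continuous.tendsto a).comp this
  have hm : ∀ q : Polynomial ℝ, Tendsto (fun n => q.eval (x n - h n)) atTop (𝓝 (q.eval a)) := by
    intro q
    have := hx.sub hh
    rw [sub_zero] at this
    exact (q.continuous.tendsto a).comp this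
  -- The induction over `q ↦ X * q` also carries the first symmetric difference quotient.
  suffices H : ∀ m : ℕ,
      Tendsto (fun n => ((x n + h n) ^ m - (x n - h n) ^ m) / h n) atTop
        (𝓝 (2 * (Polynomial.X ^ m : Polynomial ℝ).derivative.eval a)) ∧
      Tendsto (fun n => ((x n + h n) ^ m - 2 * x n ^ m + (x n - h n) ^ m) / h n ^ 2) atTop
        (𝓝 ((Polynomial.X ^ m : Polynomial ℝ).derivative.derivative.eval a)) by
    induction p using Polynomial.induction_on' with
    | add p q hp hq =>
      simp only [Polynomial.eval_add, Polynomial.derivative_add]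
      refine (hp.add hq).congr fun n => ?_
      ring
    | monomial m b =>
      rw [← Polynomial.C_mul_X_pow_eq_monomial]
      simp only [Polynomial.derivative_C_mul, Polynomial.eval_C_mul, Polynomial.eval_pow,
        Polynomial.eval_X]
      refine ((H m).2.const_mul b).congr fun n => ?_
      ring
  intro m
  induction m with
  | zero => simp; norm_num
  | succ m ih =>
    obtain ⟨ih1, ih2⟩ := ih
    have e1 : ∀ᶠ n in atTop, x n * (((x n + h n) ^ m - (x n - h n) ^ m) / h n) +
        ((x n + h n) ^ m + (x n - h n) ^ m) =
        ((x n + h n) ^ (m + 1) - (x n - h n) ^ (m + 1)) / h n := by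
      filter_upwards [h0] with n hn
      field_simp
      ring
    have e2 : ∀ᶠ n in atTop,
        x n * (((x n + h n) ^ m - 2 * x n ^ m + (x n - h n) ^ m) / h n ^ 2) +
        (((x n + h n) ^ m - (x n - h n) ^ m) / h n) =
        ((x n + h n) ^ (m + 1) - 2 * x n ^ (m + 1) + (x n - h n) ^ (m + 1)) / h n ^ 2 := by
      filter_upwards [h0] with n hn
      field_simp
      ring
    have hd : ((Polynomial.X : Polynomial ℝ) ^ (m + 1)).derivative =
        Polynomial.X ^ m + Polynomial.X * (Polynomial.X ^ m : Polynomial ℝ).derivative := by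
      rw [pow_succ', Polynomial.derivative_mul, Polynomial.derivative_X, one_mul]
    constructor
    · have hpm := (hp (Polynomial.X ^ m)).add (hm (Polynomial.X ^ m))
      simp only [Polynomial.eval_pow, Polynomial.eval_X] at hpm
      convert ((hx.mul ih1).add hpm).congr' e1 using 2
      rw [hd]; simp; ring
    · convert ((hx.mul ih2).add ih1).congr' e2 using 2
      rw [hd]; simp; ring

/-! ### Densities in step permutons -/

/-- Lebesgue measure on the interval with index `t` among `n` equal parts of the unit interval.
Half-open intervals make the parts disjoint; this differs from closed intervals by null sets. -/
noncomputable def cellMeasure (n : ℕ) (t : Fin n) : Measure ℝ :=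
  volume.restrict (Set.Ioc ((t : ℝ) / n) (((t : ℝ) + 1) / n))

instance (n : ℕ) (t : Fin n) : IsFiniteMeasure (cellMeasure n t) := by
  unfold cellMeasure; infer_instance

lemma sum_cellMeasure {n : ℕ} (hn : 0 < n) : ∑ t : Fin n, cellMeasure n t = unitMeasure := by
  have hn' : (0 : ℝ) < n := by exact_mod_cast hn
  have h1 : Set.Ioc (0 : ℝ) 1 = ⋃ t : Fin n, Set.Ioc ((t : ℝ) / n) (((t : ℝ) + 1) / n) := by
    ext x
    simp only [Set.mem_Ioc, Set.mem_iUnion]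
    constructor
    · rintro ⟨h0, h1⟩
      have hpos : 0 < ⌈x * n⌉₊ := Nat.ceil_pos.2 (by positivity)
      have hle : ⌈x * n⌉₊ ≤ n := Nat.ceil_le.2 (by nlinarith)
      have hc : ((⌈x * n⌉₊ - 1 : ℕ) : ℝ) + 1 = ⌈x * n⌉₊ := by
        rw [Nat.cast_sub hpos]; simp
      refine ⟨⟨⌈x * n⌉₊ - 1, by omega⟩, ?_, ?_⟩
      · rw [div_lt_iff₀ hn']
        have := Nat.ceil_lt_add_one (a := x * n) (by positivity)
        simp only
        linarith
      · rw [le_div_iff₀ hn']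
        simp only [hc]
        exact Nat.le_ceil _
    · rintro ⟨t, h0, h1⟩
      refine ⟨lt_of_le_of_lt (by positivity) h0, h1.trans ?_⟩
      rw [div_le_one hn']
      exact_mod_cast t.isLt
  unfold unitMeasure cellMeasure
  rw [h1, Measure.restrict_iUnion, Measure.sum_fintype]
  · intro s t hst
    refine Set.disjoint_left.2 ?_
    rintro x ⟨h1, h2⟩ ⟨h3, h4⟩
    refine hst (Fin.ext ?_)
    rw [div_lt_iff₀ hn'] at h1 h3
    rw [le_div_iff₀ hn'] at h2 h4
    have h5 : (s : ℝ) < t + 1 := by linarith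
    have h6 : (t : ℝ) < s + 1 := by linarith
    norm_cast at h5 h6
    omega
  · exact fun t => measurableSet_Ioc

lemma stepPermuton_eq_sum_prod {n : ℕ} (M : Matrix (Fin n) (Fin n) ℝ) :
    stepPermuton M = ∑ t : Fin n × Fin n, ENNReal.ofReal (n * M t.1 t.2) •
      (cellMeasure n t.1).prod (cellMeasure n t.2) := by
  unfold stepPermuton cellMeasure
  rw [Fintype.sum_prod_type]
  refine Finset.sum_congr rfl fun i _ => Finset.sum_congr rfl fun j _ => ?_
  rw [Measure.prod_restrict, ← Measure.volume_eq_prod]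
  congr 1
  exact Measure.restrict_congr_set
    (Measure.set_prod_ae_eq Ioc_ae_eq_Icc Ioc_ae_eq_Icc).symm

/-- The measure of the points of the box `∏ₘ [rₘ/n, (rₘ+1)/n]` that `τ` lists increasingly. -/
noncomputable def sortedBoxWeight {n k : ℕ} (τ : Equiv.Perm (Fin k)) (r : Fin k → Fin n) : ℝ :=
  (Measure.pi fun m => cellMeasure n (r m)).real {u | StrictMono (fun i => u (τ i))}

/-- The Lebesgue measure of the configurations that induce `π` and whose point with index `m` lies
in the tile `c m`. -/
noncomputable def tileWeight {n k : ℕ} (π : Equiv.Perm (Fin k)) (c : Fin k → Fin n × Fin n) : ℝ :=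
  (Measure.pi fun m => (cellMeasure n (c m).1).prod (cellMeasure n (c m).2)).real
    {p | Induces p π}

lemma permutonDensity_stepPermuton {n : ℕ} (π : Permutation) (M : Matrix (Fin n) (Fin n) ℝ)
    (hM : ∀ i j, 0 ≤ M i j) :
    permutonDensity π (stepPermuton M) =
      ∑ c : Fin π.1 → Fin n × Fin n, (∏ m, (n * M (c m).1 (c m).2)) * tileWeight π.2 c := by
  have h1 : ∀ t : Fin n × Fin n, IsFiniteMeasure (ENNReal.ofReal (n * M t.1 t.2) •
      (cellMeasure n t.1).prod (cellMeasure n t.2)) :=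
    fun t => Measure.smul_finite _ ENNReal.ofReal_ne_top
  unfold permutonDensity tileWeight
  rw [stepPermuton_eq_sum_prod, pi_finsetSum (ι := Fin π.1) (fun _ => Finset.univ)
    (fun _ (t : Fin n × Fin n) => ENNReal.ofReal (n * M t.1 t.2) • (cellMeasure n t.1).prod (cellMeasure n t.2)),
    Fintype.piFinset_univ, measureReal_def, Measure.finsetSum_apply, ENNReal.toReal_sum]
  · refine Finset.sum_congr rfl fun c _ => ?_
    rw [pi_smul_measure _ fun _ => ENNReal.ofReal_ne_top]
    simp only [Measure.smul_apply, smul_eq_mul, ENNReal.toReal_mul, ENNReal.toReal_prod,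
      measureReal_def]
    congr 1
    refine Finset.prod_congr rfl fun m _ => ENNReal.toReal_ofReal ?_
    have := hM (c m).1 (c m).2
    positivity
  · intro c _
    rw [pi_smul_measure _ fun _ => ENNReal.ofReal_ne_top]
    simp only [Measure.smul_apply, smul_eq_mul]
    exact ENNReal.mul_ne_top (ENNReal.prod_ne_top fun _ _ => ENNReal.ofReal_ne_top)
      (measure_ne_top _ _)

/-- The horizontal and vertical orders of a configuration are independent for product measures,
once the order `σ` in which the points are listed is fixed. -/
lemma tileWeight_eq_sum {n k : ℕ} (π : Equiv.Perm (Fin k)) (c : Fin k → Fin n × Fin n) :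
    tileWeight π c = ∑ σ : Equiv.Perm (Fin k),
      sortedBoxWeight σ (fun m => (c m).1) * sortedBoxWeight (σ * π⁻¹) (fun m => (c m).2) := by
  unfold tileWeight sortedBoxWeight
  have hset : {p : Fin k → ℝ × ℝ | Induces p π} = ⋃ σ : Equiv.Perm (Fin k),
      MeasurableEquiv.arrowProdEquivProdArrow ℝ ℝ (Fin k) ⁻¹'
        ({u | StrictMono (fun i => u (σ i))} ×ˢ {v | StrictMono (fun i => v ((σ * π⁻¹) i))}) := by
    ext p
    rw [Set.mem_ofPred_eq, induces_iff, Set.mem_iUnion]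
    rfl
  have hm : ∀ σ : Equiv.Perm (Fin k), MeasurableSet
      ({u : Fin k → ℝ | StrictMono (fun i => u (σ i))} ×ˢ
        {v : Fin k → ℝ | StrictMono (fun i => v ((σ * π⁻¹) i))}) := fun σ =>
    (measurableSet_strictMono_comp _).prod (measurableSet_strictMono_comp _)
  rw [hset, measureReal_iUnion_fintype]
  · refine Finset.sum_congr rfl fun σ _ => ?_
    rw [(measurePreserving_arrowProdEquivProdArrow ℝ ℝ (Fin k) _ _).measureReal_preimage
      (hm σ).nullMeasurableSet, measureReal_prod_prod]
  · intro σ τ hst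
    refine Set.disjoint_left.2 ?_
    rintro p ⟨h1, -⟩ ⟨h2, -⟩
    exact hst (perm_eq_of_strictMono h1 h2)
  · exact fun σ => (MeasurableEquiv.measurable _) (hm σ)

lemma sum_sortedBoxWeight {n k : ℕ} (A : Fin k → Finset (Fin n)) (τ : Equiv.Perm (Fin k)) :
    ∑ r ∈ Fintype.piFinset A, sortedBoxWeight τ r =
      (Measure.pi fun m => ∑ t ∈ A m, cellMeasure n t).real
        {u | StrictMono (fun i => u (τ i))} := by
  unfold sortedBoxWeight
  rw [pi_finsetSum A (fun _ t => cellMeasure n t), measureReal_def, Measure.finsetSum_apply,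
    ENNReal.toReal_sum (fun _ _ => measure_ne_top _ _)]
  rfl

lemma sum_univ_sortedBoxWeight {n k : ℕ} (hn : 0 < n) (τ : Equiv.Perm (Fin k)) :
    ∑ r : Fin k → Fin n, sortedBoxWeight τ r = 1 / (k.factorial : ℝ) := by
  rw [← Fintype.piFinset_univ, sum_sortedBoxWeight, sum_cellMeasure hn,
    ← measureReal_strictMono k,
    ← (measurePreserving_comp_injective unitMeasure τ.injective).measureReal_preimage
      (measurableSet_strictMono_comp (fun i => i)).nullMeasurableSet]
  rfl

/-- If the coordinate with index `m` is confined to the cell `t`, the total weight is the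
probability that the corresponding order statistic falls into this cell. -/
lemma sum_sortedBoxWeight_of_cell {n k : ℕ} (hn : 0 < n) (τ : Equiv.Perm (Fin k)) (m : Fin k)
    (t : Fin n) :
    ∑ r ∈ Finset.univ.filter (fun r : Fin k → Fin n => r m = t), sortedBoxWeight τ r =
      (orderStatPoly k (τ⁻¹ m)).eval (((t : ℝ) + 1) / n) -
        (orderStatPoly k (τ⁻¹ m)).eval ((t : ℝ) / n) := by
  have hn' : (0 : ℝ) < n := by exact_mod_cast hn
  set I := Set.Ioc ((t : ℝ) / n) (((t : ℝ) + 1) / n) with hI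
  have h0 : (0 : ℝ) ≤ (t : ℝ) / n := by positivity
  have h1 : ((t : ℝ) + 1) / n ≤ 1 := by
    rw [div_le_one hn']
    exact_mod_cast t.isLt
  have h01 : (t : ℝ) / n ≤ ((t : ℝ) + 1) / n := by gcongr; linarith
  have hA : Finset.univ.filter (fun r : Fin k → Fin n => r m = t) =
      Fintype.piFinset fun m' => if m' = m then {t} else Finset.univ := by
    ext r
    simp only [Finset.mem_filter, Finset.mem_univ, true_and, Fintype.mem_piFinset]
    constructor
    · intro h m'
      split_ifs with hm
      · simp [hm, h]
      · simp
    · intro h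
      simpa using h m
  have hcell : ∀ m', ∑ s ∈ (if m' = m then {t} else Finset.univ : Finset (Fin n)),
      cellMeasure n s = unitMeasure.restrict (if m' = m then I else Set.univ) := by
    intro m'
    split_ifs
    · rw [Finset.sum_singleton, unitMeasure, Measure.restrict_restrict measurableSet_Ioc, cellMeasure]
      congr 1
      symm
      exact Set.inter_eq_left.2 (Set.Ioc_subset_Ioc h0 h1)
    · rw [Measure.restrict_univ, sum_cellMeasure hn]
  have hbox : (Set.univ.pi fun m' : Fin k => if m' = m then I else Set.univ) =
      {u | u m ∈ I} := by
    ext u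
    simp only [Set.mem_univ_pi, Set.mem_ofPred_eq]
    constructor
    · intro h
      simpa using h m
    · intro h m'
      split_ifs with hm
      · simpa [hm] using h
      · trivial
  rw [hA, sum_sortedBoxWeight]
  simp only [hcell]
  rw [← Measure.restrict_pi_pi, hbox, measureReal_restrict_apply (measurableSet_strictMono_comp _)]
  set F : ℝ → Set (Fin k → ℝ) := fun c => {u | StrictMono u ∧ u (τ⁻¹ m) ≤ c} with hF
  have hFm : ∀ c, MeasurableSet (F c) := fun c =>
    (measurableSet_strictMono_comp (fun i => i)).inter
      (measurableSet_le (measurable_pi_apply _) measurable_const)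
  have hpre : {u : Fin k → ℝ | StrictMono (fun i => u (τ i))} ∩ {u | u m ∈ I} =
      (fun (u : Fin k → ℝ) i => u (τ i)) ⁻¹' (F (((t : ℝ) + 1) / n) \ F ((t : ℝ) / n)) := by
    ext u
    simp only [Set.mem_inter_iff, Set.mem_ofPred_eq, Set.mem_preimage, Set.mem_sdiff, hF, hI,
      Set.mem_Ioc]
    rw [show τ (τ⁻¹ m) = m from τ.apply_symm_apply m]
    constructor
    · rintro ⟨h, h2, h3⟩
      exact ⟨⟨h, h3⟩, fun h4 => absurd h4.2 (not_le.2 h2)⟩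
    · rintro ⟨⟨h, h3⟩, h4⟩
      exact ⟨h, not_le.1 fun h5 => h4 ⟨h, h5⟩, h3⟩
  rw [hpre, (measurePreserving_comp_injective unitMeasure τ.injective).measureReal_preimage
    ((hFm _).diff (hFm _)).nullMeasurableSet, measureReal_sdiff _ (hFm _),
    measureReal_strictMono_le _ (h0.trans h01) h1,
    measureReal_strictMono_le _ h0 (h01.trans h1)]
  exact fun u hu => ⟨hu.1, hu.2.trans h01⟩

lemma sum_mul_sortedBoxWeight {n k : ℕ} (hn : 0 < n) (τ : Equiv.Perm (Fin k)) (m : Fin k)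
    (d : Fin n → ℝ) :
    ∑ r : Fin k → Fin n, d (r m) * sortedBoxWeight τ r =
      ∑ t, d t * ((orderStatPoly k (τ⁻¹ m)).eval (((t : ℝ) + 1) / n) -
        (orderStatPoly k (τ⁻¹ m)).eval ((t : ℝ) / n)) := by
  rw [← Finset.sum_fiberwise (s := Finset.univ) (g := fun r : Fin k → Fin n => r m)]
  refine Finset.sum_congr rfl fun t _ => ?_
  rw [← sum_sortedBoxWeight_of_cell hn, Finset.mul_sum]
  refine Finset.sum_congr rfl fun r hr => ?_
  rw [(Finset.mem_filter.1 hr).2]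

/-- The density of `π` in the uniform permuton: each of the `k!` listings of the points contributes
`(1 / k!) ^ 2`, one factor for each coordinate. -/
lemma sum_tileWeight {n k : ℕ} (hn : 0 < n) (π : Equiv.Perm (Fin k)) :
    ∑ c : Fin k → Fin n × Fin n, tileWeight π c = 1 / (k.factorial : ℝ) := by
  simp only [tileWeight_eq_sum]
  rw [Finset.sum_comm]
  have h : ∀ σ : Equiv.Perm (Fin k), ∑ c : Fin k → Fin n × Fin n,
      sortedBoxWeight σ (fun m => (c m).1) * sortedBoxWeight (σ * π⁻¹) (fun m => (c m).2) =
      1 / (k.factorial : ℝ) * (1 / (k.factorial : ℝ)) := by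
    intro σ
    rw [← Equiv.sum_comp (Equiv.arrowProdEquivProdArrow (Fin k) (fun _ => Fin n)
      (fun _ => Fin n)).symm, Fintype.sum_prod_type]
    simp only [Equiv.arrowProdEquivProdArrow]
    change ∑ r : Fin k → Fin n, ∑ q : Fin k → Fin n,
      sortedBoxWeight σ r * sortedBoxWeight (σ * π⁻¹) q = _
    rw [← Finset.sum_mul_sum, sum_univ_sortedBoxWeight hn, sum_univ_sortedBoxWeight hn]
  simp only [h, Finset.sum_const, Finset.card_univ, Fintype.card_perm, Fintype.card_fin,
    nsmul_eq_mul]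
  have hk : (k.factorial : ℝ) ≠ 0 := by positivity
  field_simp

/-- The first-order effect on the density of `π` of a perturbation of rank one. -/
lemma sum_tileWeight_mul_rankOne {n k : ℕ} (hn : 0 < n) (π : Equiv.Perm (Fin k))
    (d e : Fin n → ℝ) :
    ∑ c : Fin k → Fin n × Fin n, tileWeight π c * ∑ m, d (c m).1 * e (c m).2 =
      k.factorial * ∑ i,
        (∑ t, d t * ((orderStatPoly k i).eval (((t : ℝ) + 1) / n) -
          (orderStatPoly k i).eval ((t : ℝ) / n))) *
        (∑ t, e t * ((orderStatPoly k (π i)).eval (((t : ℝ) + 1) / n) -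
          (orderStatPoly k (π i)).eval ((t : ℝ) / n))) := by
  set D : Fin k → ℝ := fun i => ∑ t, d t * ((orderStatPoly k i).eval (((t : ℝ) + 1) / n) -
          (orderStatPoly k i).eval ((t : ℝ) / n)) with hD
  set E : Fin k → ℝ := fun i => ∑ t, e t * ((orderStatPoly k i).eval (((t : ℝ) + 1) / n) -
          (orderStatPoly k i).eval ((t : ℝ) / n)) with hE
  have h : ∀ (σ : Equiv.Perm (Fin k)) (m : Fin k), ∑ c : Fin k → Fin n × Fin n,
      (sortedBoxWeight σ (fun m => (c m).1) * sortedBoxWeight (σ * π⁻¹) (fun m => (c m).2)) *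
        (d (c m).1 * e (c m).2) = D (σ⁻¹ m) * E (π (σ⁻¹ m)) := by
    intro σ m
    rw [← Equiv.sum_comp (Equiv.arrowProdEquivProdArrow (Fin k) (fun _ => Fin n)
      (fun _ => Fin n)).symm, Fintype.sum_prod_type]
    change ∑ r : Fin k → Fin n, ∑ q : Fin k → Fin n,
      (sortedBoxWeight σ r * sortedBoxWeight (σ * π⁻¹) q) * (d (r m) * e (q m)) = _
    have h2 : ∀ r q : Fin k → Fin n,
        (sortedBoxWeight σ r * sortedBoxWeight (σ * π⁻¹) q) * (d (r m) * e (q m)) =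
        (d (r m) * sortedBoxWeight σ r) * (e (q m) * sortedBoxWeight (σ * π⁻¹) q) := by
      intro r q; ring
    simp only [h2]
    rw [← Finset.sum_mul_sum, sum_mul_sortedBoxWeight hn, sum_mul_sortedBoxWeight hn]
    simp [hD, hE]
  calc _ = ∑ σ : Equiv.Perm (Fin k), ∑ m, D (σ⁻¹ m) * E (π (σ⁻¹ m)) := by
        simp only [tileWeight_eq_sum, ← h, Finset.sum_mul_sum]
        rw [Finset.sum_comm]
        refine Finset.sum_congr rfl fun σ _ => ?_
        rw [Finset.sum_comm]
    _ = ∑ σ : Equiv.Perm (Fin k), ∑ i, D i * E (π i) :=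
        Finset.sum_congr rfl fun σ _ => Equiv.sum_comp σ⁻¹ fun i => D i * E (π i)
    _ = _ := by simp [Fintype.card_perm, hD, hE]

/-! ### The gradient of the density function -/

lemma perturbedMatrix_apply {n : ℕ} (x : Matrix (Fin (n - 1)) (Fin (n - 1)) ℝ) (i j : Fin n) :
    perturbedMatrix n x i j = 1 / (n : ℝ) + ∑ k, ∑ l, x k l * perturbation n k l i j := by
  simp [perturbedMatrix, constMatrix, Matrix.add_apply, Matrix.sum_apply]

lemma densityFunction_of_eq_const {n : ℕ} (hn : 0 < n) (π : Permutation)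
    (x : Matrix (Fin (n - 1)) (Fin (n - 1)) ℝ)
    (hx : ∀ i j, perturbedMatrix n x i j = 1 / (n : ℝ)) :
    densityFunction π n x = 1 / (π.1.factorial : ℝ) := by
  have hn' : (n : ℝ) ≠ 0 := by positivity
  unfold densityFunction
  rw [permutonDensity_stepPermuton π _ fun i j => by rw [hx]; positivity]
  simp only [hx, mul_one_div_cancel hn', Finset.prod_const_one, one_mul]
  exact sum_tileWeight hn π.2

lemma eventually_nonneg_perturbedMatrix {E : Type*} [NormedAddCommGroup E] [NormedSpace ℝ E]
    {n : ℕ} (hn : 0 < n) {f : E → Matrix (Fin (n - 1)) (Fin (n - 1)) ℝ}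
    {ℓ : Fin n → Fin n → E →L[ℝ] ℝ}
    (hf : ∀ s i j, perturbedMatrix n (f s) i j = 1 / (n : ℝ) + ℓ i j s) :
    ∀ᶠ s in 𝓝 (0 : E), ∀ i j, 0 ≤ perturbedMatrix n (f s) i j := by
  simp only [hf]
  rw [eventually_all]; intro i
  rw [eventually_all]; intro j
  have hc : ContinuousAt (fun s : E => 1 / (n : ℝ) + ℓ i j s) 0 := by fun_prop
  have h0 : (0 : ℝ) < 1 / (n : ℝ) + ℓ i j 0 := by simpa using hn
  filter_upwards [hc.eventually (lt_mem_nhds h0)] with s hs using hs.le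

/-- The density function along a linear family of perturbations: near the origin all entries of
the matrix are positive, and the density is a polynomial in them. -/
lemma hasStrictFDerivAt_densityFunction {E : Type*} [NormedAddCommGroup E] [NormedSpace ℝ E]
    {n : ℕ} (hn : 0 < n) (π : Permutation) (f : E → Matrix (Fin (n - 1)) (Fin (n - 1)) ℝ)
    (ℓ : Fin n → Fin n → E →L[ℝ] ℝ)
    (hf : ∀ s i j, perturbedMatrix n (f s) i j = 1 / (n : ℝ) + ℓ i j s) :
    HasStrictFDerivAt (fun s => densityFunction π n (f s))
      (∑ c : Fin π.1 → Fin n × Fin n, tileWeight π.2 c • ∑ m, (n : ℝ) • ℓ (c m).1 (c m).2) 0 := by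
  have hn' : (n : ℝ) ≠ 0 := by positivity
  have hpoly : HasStrictFDerivAt (fun s : E => ∑ c : Fin π.1 → Fin n × Fin n,
      (∏ m, (n * (1 / (n : ℝ) + ℓ (c m).1 (c m).2 s))) * tileWeight π.2 c)
      (∑ c : Fin π.1 → Fin n × Fin n, tileWeight π.2 c • ∑ m, (n : ℝ) • ℓ (c m).1 (c m).2)
      0 := by
    refine HasStrictFDerivAt.fun_sum fun c _ => HasStrictFDerivAt.mul_const ?_ _
    have h1 : ∀ m ∈ (Finset.univ : Finset (Fin π.1)), HasStrictFDerivAt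
        (fun s : E => n * (1 / (n : ℝ) + ℓ (c m).1 (c m).2 s))
        ((n : ℝ) • ℓ (c m).1 (c m).2) 0 := fun m _ =>
      ((ℓ (c m).1 (c m).2).hasStrictFDerivAt.const_add _).const_mul _
    convert HasStrictFDerivAt.finsetProd h1 using 1
    refine Finset.sum_congr rfl fun m _ => ?_
    simp [hn']
  refine hpoly.congr_of_eventuallyEq ?_
  filter_upwards [eventually_nonneg_perturbedMatrix hn hf] with s hs
  rw [densityFunction, permutonDensity_stepPermuton π _ hs]
  simp only [hf]

/-- The vector `e_{a-1} - e_a`, with entries indexed from `0`: the matrices `B^{k,l}` are products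
of two such vectors. -/
def stepDiff {n : ℕ} (a : ℕ) (i : Fin n) : ℝ :=
  (if i.val + 1 = a then 1 else 0) - if i.val = a then 1 else 0

lemma perturbation_apply {n : ℕ} (k l : Fin (n - 1)) (i j : Fin n) :
    perturbation n k l i j = stepDiff (k.val + 1) i * stepDiff (l.val + 1) j := by
  simp only [perturbation, stepDiff, Matrix.of_apply]
  split_ifs <;> first | omega | norm_num

lemma sum_unitMatrix_mul_perturbation {n a b : ℕ} (ha : a ∈ Set.Ico 1 n) (hb : b ∈ Set.Ico 1 n)
    (i j : Fin n) :
    ∑ k, ∑ l, unitMatrix n a b k l * perturbation n k l i j = stepDiff a i * stepDiff b j := by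
  obtain ⟨ha1, ha2⟩ := ha
  obtain ⟨hb1, hb2⟩ := hb
  rw [Finset.sum_eq_single ⟨a - 1, by omega⟩, Finset.sum_eq_single ⟨b - 1, by omega⟩]
  · simp [perturbation_apply, unitMatrix, Nat.sub_add_cancel ha1, Nat.sub_add_cancel hb1]
  · intro l _ hl
    have : l.val + 1 ≠ b := fun h => hl (Fin.ext (by simp; omega))
    simp [unitMatrix, this]
  · simp
  · intro k _ hk
    have : k.val + 1 ≠ a := fun h => hk (Fin.ext (by simp; omega))
    simp [unitMatrix, this]
  · simp

lemma sum_stepDiff_mul {n a : ℕ} (ha : a ∈ Set.Ico 1 n) (g : Fin n → ℝ) :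
    ∑ t, stepDiff a t * g t = g ⟨a - 1, (Nat.sub_le a 1).trans_lt ha.2⟩ - g ⟨a, ha.2⟩ := by
  have h1 : ∀ t : Fin n, (t.val + 1 = a ↔ t = ⟨a - 1, (Nat.sub_le a 1).trans_lt ha.2⟩) := by
    have := ha.1
    intro t
    rw [Fin.ext_iff]
    simp only
    omega
  have h2 : ∀ t : Fin n, (t.val = a ↔ t = ⟨a, ha.2⟩) := fun t => by rw [Fin.ext_iff]
  simp only [stepDiff, sub_mul, Finset.sum_sub_distrib, h1, h2, ite_mul, one_mul, zero_mul,
    Finset.sum_ite_eq', Finset.mem_univ, if_true]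

lemma sum_stepDiff_mul_eval {n a : ℕ} (ha : a ∈ Set.Ico 1 n) (p : Polynomial ℝ) :
    ∑ t : Fin n, stepDiff a t * (p.eval (((t : ℝ) + 1) / n) - p.eval ((t : ℝ) / n)) =
      -(p.eval ((a : ℝ) / n + 1 / n) - 2 * p.eval ((a : ℝ) / n) + p.eval ((a : ℝ) / n - 1 / n)) := by
  have hc : ((a - 1 : ℕ) : ℝ) = a - 1 := by rw [Nat.cast_sub ha.1]; simp
  rw [sum_stepDiff_mul ha]
  simp only [hc]
  rw [← add_div, ← sub_div, sub_add_cancel]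
  ring

/-- The second-order difference at `a/n` with step `1/n` of the distribution polynomial of an order statistic. -/
noncomputable def orderStatDiff (n k : ℕ) (i : Fin k) (a : ℕ) : ℝ :=
  (orderStatPoly k i).eval ((a : ℝ) / n + 1 / n) - 2 * (orderStatPoly k i).eval ((a : ℝ) / n) +
    (orderStatPoly k i).eval ((a : ℝ) / n - 1 / n)

lemma sum_tileWeight_mul_stepDiff {n k a b : ℕ} (ha : a ∈ Set.Ico 1 n) (hb : b ∈ Set.Ico 1 n)
    (π : Equiv.Perm (Fin k)) :
    ∑ c : Fin k → Fin n × Fin n, tileWeight π c *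
        ∑ m, n * (stepDiff a (c m).1 * stepDiff b (c m).2) =
      n * (k.factorial * ∑ i, orderStatDiff n k i a * orderStatDiff n k (π i) b) := by
  have hn : 0 < n := by have := ha.2; omega
  have h := sum_tileWeight_mul_rankOne hn π (stepDiff a) (stepDiff b)
  simp only [sum_stepDiff_mul_eval ha, sum_stepDiff_mul_eval hb, neg_mul_neg] at h
  unfold orderStatDiff
  rw [← h, Finset.mul_sum]
  refine Finset.sum_congr rfl fun c _ => ?_
  rw [← Finset.mul_sum]
  ring

lemma densityPartial_eq {n a b : ℕ} (ha : a ∈ Set.Ico 1 n) (hb : b ∈ Set.Ico 1 n)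
    (π : Permutation) :
    densityPartial π n a b = n * (π.1.factorial *
      ∑ i, orderStatDiff n π.1 i a * orderStatDiff n π.1 (π.2 i) b) := by
  have hn : 0 < n := by have := ha.2; omega
  have h := hasStrictFDerivAt_densityFunction (E := ℝ) hn π (fun t => t • unitMatrix n a b)
    (fun i j => (stepDiff a i * stepDiff b j) • ContinuousLinearMap.id ℝ ℝ) (by
      intro s i j
      rw [perturbedMatrix_apply, ← sum_unitMatrix_mul_perturbation ha hb]
      simp [Finset.mul_sum, mul_comm, mul_left_comm])
  have h2 := h.hasFDerivAt.hasDerivAt.deriv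
  rw [densityPartial, lineDeriv]
  simp only [zero_add]
  rw [h2, ← sum_tileWeight_mul_stepDiff ha hb]
  simp [Finset.mul_sum]

/-- The gradient polynomial: up to the factor `k!` it is the sum over `i` of the products of the
second derivatives of the order statistic polynomials of `i` and `π i`. -/
noncomputable def explicitGradient (π : Permutation) : MvPolynomial (Fin 2) ℝ :=
  MvPolynomial.C (π.1.factorial : ℝ) * ∑ i,
    Polynomial.aeval (MvPolynomial.X 0) (orderStatPoly π.1 i).derivative.derivative *
    Polynomial.aeval (MvPolynomial.X 1) (orderStatPoly π.1 (π.2 i)).derivative.derivative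

lemma eval_aeval_X (p : Polynomial ℝ) (v : Fin 2 → ℝ) (j : Fin 2) :
    MvPolynomial.eval v (Polynomial.aeval (MvPolynomial.X j) p) = p.eval (v j) := by
  have h : (MvPolynomial.eval v).comp MvPolynomial.C = RingHom.id ℝ := by ext; simp
  rw [Polynomial.aeval_def, Polynomial.hom_eval₂, MvPolynomial.algebraMap_eq, h,
    MvPolynomial.eval_X, Polynomial.eval₂_id]

lemma eval_explicitGradient (π : Permutation) (α β : ℝ) :
    MvPolynomial.eval ![α, β] (explicitGradient π) = π.1.factorial * ∑ i,
      (orderStatPoly π.1 i).derivative.derivative.eval α *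
      (orderStatPoly π.1 (π.2 i)).derivative.derivative.eval β := by
  simp [explicitGradient, eval_aeval_X]

lemma tendsto_floor_div {α : ℝ} (hα : 0 < α) :
    Tendsto (fun n : ℕ => (⌊α * n⌋₊ : ℝ) / n) atTop (𝓝 α) :=
  (tendsto_nat_floor_mul_div_atTop hα.le).comp tendsto_natCast_atTop_atTop

lemma eventually_floor_mem_Ico {α : ℝ} (hα : α ∈ Set.Ioo (0 : ℝ) 1) :
    ∀ᶠ n : ℕ in atTop, ⌊α * n⌋₊ ∈ Set.Ico 1 n := by
  filter_upwards [(tendsto_natCast_atTop_atTop (R := ℝ)).eventually_ge_atTop (1 / α),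
    eventually_gt_atTop 0] with n hn h0
  have hn' : (0 : ℝ) < n := by exact_mod_cast h0
  refine ⟨Nat.le_floor ?_, (Nat.floor_lt (by have := hα.1; positivity)).2 ?_⟩
  · rw [div_le_iff₀ hα.1] at hn
    simp; linarith
  · nlinarith [hα.2]

lemma isGradientPolynomial_explicitGradient (π : Permutation) :
    IsGradientPolynomial π (explicitGradient π) := by
  intro α hα β hβ
  rw [eval_explicitGradient]
  have h1n : Tendsto (fun n : ℕ => 1 / (n : ℝ)) atTop (𝓝 0) := tendsto_one_div_atTop_nhds_zero_nat
  have hne : ∀ᶠ n : ℕ in atTop, 1 / (n : ℝ) ≠ 0 := by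
    filter_upwards [eventually_gt_atTop 0] with n hn
    positivity
  have hD : ∀ (i : Fin π.1) {γ : ℝ}, γ ∈ Set.Ioo (0 : ℝ) 1 → Tendsto
      (fun n : ℕ => orderStatDiff n π.1 i ⌊γ * n⌋₊ / (1 / (n : ℝ)) ^ 2) atTop
      (𝓝 ((orderStatPoly π.1 i).derivative.derivative.eval γ)) := fun i γ hγ =>
    tendsto_second_difference _ (tendsto_floor_div hγ.1) h1n hne
  refine Tendsto.congr' ?_ ((tendsto_finsetSum Finset.univ fun i _ =>
    (hD i hα).mul (hD (π.2 i) hβ)).const_mul (π.1.factorial : ℝ))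
  filter_upwards [eventually_floor_mem_Ico hα, eventually_floor_mem_Ico hβ,
    eventually_gt_atTop 0] with n ha hb hn
  have hn' : (n : ℝ) ≠ 0 := by positivity
  rw [densityPartial_eq ha hb]
  simp only [Finset.mul_sum]
  refine Finset.sum_congr rfl fun i _ => ?_
  field_simp

lemma IsGradientPolynomial.unique {π : Permutation} {P Q : MvPolynomial (Fin 2) ℝ}
    (hP : IsGradientPolynomial π P) (hQ : IsGradientPolynomial π Q) : P = Q := by
  refine MvPolynomial.funext_set (fun _ => Set.Ioo (0 : ℝ) 1)
    (fun _ => Set.Ioo_infinite one_pos) fun x hx => ?_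
  have hx' : x = ![x 0, x 1] := by ext i; fin_cases i <;> rfl
  rw [hx']
  exact tendsto_nhds_unique (hP _ (hx 0 trivial) _ (hx 1 trivial))
    (hQ _ (hx 0 trivial) _ (hx 1 trivial))

lemma gradientPolynomial_eq (π : Permutation) : gradientPolynomial π = explicitGradient π := by
  have h : ∃ P, IsGradientPolynomial π P := ⟨_, isGradientPolynomial_explicitGradient π⟩
  rw [gradientPolynomial, dif_pos h]
  exact h.choose_spec.unique (isGradientPolynomial_explicitGradient π)

/-! ### Gradient polynomials span an infinite-dimensional space -/

lemma natDegree_derivative_derivative_orderStatPoly_le {k : ℕ} (i : Fin k) :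
    (orderStatPoly k i).derivative.derivative.natDegree ≤ k - 2 := by
  have h1 := Polynomial.natDegree_derivative_le (orderStatPoly k i).derivative
  have h2 := Polynomial.natDegree_derivative_le (orderStatPoly k i)
  have h3 := natDegree_orderStatPoly_le i
  omega

/-- On the diagonal the gradient polynomial of an identity permutation is a sum of squares, so the
leading coefficients cannot cancel. -/
lemma coeff_diagonal_explicitGradient_one_ne_zero {k : ℕ} (hk : 2 ≤ k) :
    (MvPolynomial.aeval (fun _ => (Polynomial.X : Polynomial ℝ))
      (explicitGradient ⟨k, 1⟩)).coeff ((k - 2) + (k - 2)) ≠ 0 := by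
  have hdiag : MvPolynomial.aeval (fun _ => (Polynomial.X : Polynomial ℝ))
      (explicitGradient ⟨k, 1⟩) = Polynomial.C (k.factorial : ℝ) * ∑ i : Fin k,
        (orderStatPoly k i).derivative.derivative *
          (orderStatPoly k i).derivative.derivative := by
    have h : ∀ (j : Fin 2) (p : Polynomial ℝ),
        MvPolynomial.aeval (fun _ => (Polynomial.X : Polynomial ℝ))
          (Polynomial.aeval (MvPolynomial.X j : MvPolynomial (Fin 2) ℝ) p) = p := by
      intro j p
      rw [← Polynomial.aeval_algHom_apply, MvPolynomial.aeval_X, Polynomial.aeval_X_left_apply]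
    simp only [explicitGradient, map_mul, map_sum, h, MvPolynomial.aeval_C, Equiv.Perm.coe_one,
      id_eq]
    rfl
  rw [hdiag, Polynomial.coeff_C_mul, Polynomial.finsetSum_coeff]
  refine mul_ne_zero (by positivity) (ne_of_gt ?_)
  have hc : ∀ i : Fin k, ((orderStatPoly k i).derivative.derivative *
      (orderStatPoly k i).derivative.derivative).coeff ((k - 2) + (k - 2)) =
      (orderStatPoly k i).derivative.derivative.coeff (k - 2) ^ 2 := by
    intro i
    rw [Polynomial.coeff_mul_add_eq_of_natDegree_le
      (natDegree_derivative_derivative_orderStatPoly_le i)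
      (natDegree_derivative_derivative_orderStatPoly_le i), sq]
  simp only [hc]
  refine Finset.sum_pos' (fun i _ => sq_nonneg _) ⟨⟨k - 1, by omega⟩, Finset.mem_univ _, ?_⟩
  have hlast : (orderStatPoly k ⟨k - 1, by omega⟩).derivative.derivative.coeff (k - 2) =
      1 / (k.factorial : ℝ) * k * ((k - 1 : ℕ) : ℝ) := by
    rw [orderStatPoly_last _ (by simp; omega), Polynomial.derivative_C_mul,
      Polynomial.derivative_X_pow, Polynomial.derivative_C_mul, Polynomial.derivative_C_mul,
      Polynomial.derivative_X_pow, Polynomial.coeff_C_mul, Polynomial.coeff_C_mul,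
      Polynomial.coeff_C_mul, Polynomial.coeff_X_pow]
    have : k - 2 = k - 1 - 1 := by omega
    simp [this]
    ring
  rw [hlast]
  have h1 : (0 : ℝ) < ((k - 1 : ℕ) : ℝ) := by exact_mod_cast (by omega : 0 < k - 1)
  have h2 : (0 : ℝ) < k := by exact_mod_cast (by omega : 0 < k)
  positivity

lemma exists_explicitGradient_notMem_span (S : Finset Permutation) :
    ∃ π : Permutation, explicitGradient π ∉ Submodule.span ℝ (explicitGradient '' (S : Set _)) := by
  set φ : MvPolynomial (Fin 2) ℝ →ₗ[ℝ] Polynomial ℝ :=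
    (MvPolynomial.aeval (fun _ => (Polynomial.X : Polynomial ℝ))).toLinearMap with hφ
  set k := (S.sup fun π => (φ (explicitGradient π)).natDegree) + 3 with hk
  refine ⟨⟨k, 1⟩, fun hmem => coeff_diagonal_explicitGradient_one_ne_zero (k := k) (by omega) ?_⟩
  have hle : Submodule.span ℝ (explicitGradient '' (S : Set Permutation)) ≤
      LinearMap.ker (Polynomial.lcoeff ℝ ((k - 2) + (k - 2)) ∘ₗ φ) := by
    rw [Submodule.span_le]
    rintro _ ⟨π, hπ, rfl⟩
    have h1 : (φ (explicitGradient π)).natDegree ≤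
        S.sup fun π => (φ (explicitGradient π)).natDegree :=
      Finset.le_sup (f := fun π => (φ (explicitGradient π)).natDegree) hπ
    simp only [SetLike.mem_coe, LinearMap.mem_ker, LinearMap.comp_apply, Polynomial.lcoeff_apply]
    exact Polynomial.coeff_eq_zero_of_natDegree_lt (by omega)
  exact LinearMap.mem_ker.1 (hle hmem)

/-! ### Solving for prescribed densities -/

/-- Linearly independent polynomials have linearly independent vectors of values at suitable
points. -/
lemma exists_linearIndependent_eval {ι : Type*} [Fintype ι] {P : ι → MvPolynomial (Fin 2) ℝ}
    (hP : LinearIndependent ℝ P) :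
    ∃ q : ι → ℝ × ℝ, (∀ j, q j ∈ Set.Ioo (0 : ℝ) 1 ×ˢ Set.Ioo (0 : ℝ) 1) ∧
      LinearIndependent ℝ fun j i => MvPolynomial.eval ![(q j).1, (q j).2] (P i) := by
  classical
  set ev : ℝ × ℝ → ι → ℝ := fun q i => MvPolynomial.eval ![q.1, q.2] (P i) with hev
  set V : Set (ι → ℝ) := ev '' (Set.Ioo (0 : ℝ) 1 ×ˢ Set.Ioo (0 : ℝ) 1) with hV
  -- A functional that kills all vectors of values is a linear relation between the polynomials.
  have hspan : Submodule.span ℝ V = ⊤ := by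
    by_contra hne
    obtain ⟨f, hf, hker⟩ := Submodule.exists_le_ker_of_lt_top _ (lt_top_iff_ne_top.2 hne)
    have hfv : ∀ v, f v = ∑ i, v i * f (Pi.single i 1) := by
      intro v
      conv_lhs => rw [← Finset.univ_sum_single v, map_sum]
      refine Finset.sum_congr rfl fun i _ => ?_
      rw [← smul_eq_mul, ← map_smul, ← Pi.single_smul, smul_eq_mul, mul_one]
    have hzero : ∑ i, f (Pi.single i 1) • P i = 0 := by
      refine MvPolynomial.funext_set (fun _ => Set.Ioo (0 : ℝ) 1)
        (fun _ => Set.Ioo_infinite one_pos) fun x hx => ?_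
      have hx' : x = ![x 0, x 1] := by ext i; fin_cases i <;> rfl
      have h1 : ev (x 0, x 1) ∈ Submodule.span ℝ V := Submodule.subset_span
        ⟨(x 0, x 1), ⟨hx 0 trivial, hx 1 trivial⟩, rfl⟩
      have h2 := LinearMap.mem_ker.1 (hker h1)
      rw [hfv] at h2
      rw [hx']
      simp only [map_sum, MvPolynomial.smul_eval, map_zero]
      rw [← h2]
      exact Finset.sum_congr rfl fun i _ => mul_comm _ _
    have h3 := Fintype.linearIndependent_iff.1 hP _ hzero
    refine hf (LinearMap.ext fun v => ?_)
    rw [hfv]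
    simp [h3]
  obtain ⟨b, hbV, hbspan, hb⟩ := exists_linearIndependent ℝ V
  rw [hspan] at hbspan
  have B := Module.Basis.mk hb (by rw [Subtype.range_coe, hbspan])
  have e : ι ≃ b := (Pi.basisFun ℝ ι).indexEquiv B
  choose q hq hqe using fun j : ι => hbV (e j).2
  refine ⟨q, hq, ?_⟩
  have : (fun j => ev (q j)) = (fun x : b => (x : ι → ℝ)) ∘ e := by
    funext j
    exact hqe j
  change LinearIndependent ℝ (fun j => ev (q j))
  rw [this]
  exact hb.comp e e.injective

/-- If the gradient polynomials of a finite family are linearly independent, then the density of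
one member can be changed while those of the other members keep their values for the uniform
permuton. -/
lemma exists_matrix_density_ne {ι : Type*} [Fintype ι] (π : ι → Permutation)
    (hπ : LinearIndependent ℝ fun i => explicitGradient (π i)) (i₀ : ι) :
    ∃ n : ℕ, 0 < n ∧ ∃ x : Matrix (Fin (n - 1)) (Fin (n - 1)) ℝ,
      (∀ i j, 0 ≤ perturbedMatrix n x i j) ∧
      (∀ i, i ≠ i₀ → densityFunction (π i) n x = 1 / ((π i).1.factorial : ℝ)) ∧
      densityFunction (π i₀) n x ≠ 1 / ((π i₀).1.factorial : ℝ) := by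
  classical
  obtain ⟨q, hq, hli⟩ := exists_linearIndependent_eval hπ
  have hlim : Tendsto (fun (n : ℕ) (j i : ι) =>
      (n : ℝ) ^ 3 * densityPartial (π i) n ⌊(q j).1 * n⌋₊ ⌊(q j).2 * n⌋₊) atTop
      (𝓝 fun j i => MvPolynomial.eval ![(q j).1, (q j).2] (explicitGradient (π i))) := by
    rw [tendsto_pi_nhds]; intro j
    rw [tendsto_pi_nhds]; intro i
    exact isGradientPolynomial_explicitGradient (π i) _ (hq j).1 _ (hq j).2
  -- Linear independence is an open condition, so it passes to the scaled gradients for large `n`.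
  have hev := hlim.eventually (isOpen_setOfPred_linearIndependent.mem_nhds hli)
  obtain ⟨n, hn, hn0, ha, hb⟩ := (hev.and ((eventually_gt_atTop 0).and
    ((eventually_all.2 fun j => eventually_floor_mem_Ico (hq j).1).and
      (eventually_all.2 fun j => eventually_floor_mem_Ico (hq j).2)))).exists
  set a : ι → ℕ := fun j => ⌊(q j).1 * n⌋₊ with hadef
  set b : ι → ℕ := fun j => ⌊(q j).2 * n⌋₊ with hbdef
  have hli' : LinearIndependent ℝ fun j i => (n : ℝ) ^ 3 * densityPartial (π i) n (a j) (b j) := hn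
  -- One parameter for each chosen point suffices; the other coordinates of the matrix stay zero.
  set X : (ι → ℝ) → Matrix (Fin (n - 1)) (Fin (n - 1)) ℝ :=
    fun s => ∑ j, s j • unitMatrix n (a j) (b j) with hX
  set ℓ : Fin n → Fin n → (ι → ℝ) →L[ℝ] ℝ := fun i i' =>
    ∑ j, (stepDiff (a j) i * stepDiff (b j) i') • ContinuousLinearMap.proj j with hℓ
  have hentry : ∀ s i i', perturbedMatrix n (X s) i i' = 1 / (n : ℝ) + ℓ i i' s := by
    intro s i i'
    rw [perturbedMatrix_apply]
    congr 1
    simp only [hX, hℓ, _root_.sum_apply, _root_.smul_apply,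
      ContinuousLinearMap.proj_apply, smul_eq_mul, Matrix.sum_apply, Matrix.smul_apply,
      Finset.sum_mul]
    rw [Finset.sum_congr rfl fun _ _ => Finset.sum_comm, Finset.sum_comm]
    refine Finset.sum_congr rfl fun j _ => ?_
    rw [← sum_unitMatrix_mul_perturbation (ha j) (hb j), Finset.sum_mul]
    refine Finset.sum_congr rfl fun k _ => ?_
    rw [Finset.sum_mul]
    refine Finset.sum_congr rfl fun l _ => ?_
    ring
  set F : (ι → ℝ) → ι → ℝ := fun s i => densityFunction (π i) n (X s) with hF
  have hder := hasStrictFDerivAt_pi.2 fun i : ι =>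
    hasStrictFDerivAt_densityFunction hn0 (π i) X ℓ hentry
  set L := ContinuousLinearMap.pi fun i : ι => ∑ c : Fin (π i).1 → Fin n × Fin n,
    tileWeight (π i).2 c • ∑ m, (n : ℝ) • ℓ (c m).1 (c m).2 with hL
  have hLsingle : ∀ j, L (Pi.single j 1) =
      fun i => densityPartial (π i) n (a j) (b j) := by
    intro j
    funext i
    rw [densityPartial_eq (ha j) (hb j), ← sum_tileWeight_mul_stepDiff (ha j) (hb j)]
    simp [hL, hℓ, hadef, hbdef, Pi.single_apply]
  have hrange : (L : (ι → ℝ) →ₗ[ℝ] ι → ℝ).range = ⊤ := by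
    rw [eq_top_iff, ← hli'.span_eq_top_of_card_eq_finrank' (by simp), Submodule.span_le]
    rintro _ ⟨j, rfl⟩
    refine ⟨(n : ℝ) ^ 3 • Pi.single j 1, ?_⟩
    rw [ContinuousLinearMap.coe_coe, map_smul, hLsingle]
    rfl
  have hmap : map F (𝓝 0) = 𝓝 (F 0) := hder.map_nhds_eq_of_surj hrange
  have hF0 : ∀ i, F 0 i = 1 / ((π i).1.factorial : ℝ) := fun i =>
    densityFunction_of_eq_const hn0 _ _ fun i i' => by rw [hentry]; simp
  have himage : F '' {s | ∀ i i', 0 ≤ perturbedMatrix n (X s) i i'} ∈ 𝓝 (F 0) := by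
    rw [← hmap]
    exact image_mem_map (eventually_nonneg_perturbedMatrix hn0 hentry)
  have hline : Tendsto (fun ε : ℝ => F 0 + ε • (Pi.single i₀ 1 : ι → ℝ)) (𝓝[≠] 0) (𝓝 (F 0)) := by
    have : Continuous fun ε : ℝ => F 0 + ε • (Pi.single i₀ 1 : ι → ℝ) := by fun_prop
    have h2 := this.tendsto 0
    rw [zero_smul, add_zero] at h2
    exact h2.mono_left nhdsWithin_le_nhds
  obtain ⟨ε, ⟨s, hs, hsF⟩, hε⟩ := ((hline.eventually himage).and self_mem_nhdsWithin).exists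
  refine ⟨n, hn0, X s, hs, fun i hi => ?_, ?_⟩
  · have h1 := congrFun hsF i
    simp only [Pi.add_apply, Pi.smul_apply, Pi.single_eq_of_ne hi, smul_zero, add_zero, hF0] at h1
    exact h1
  · have h1 := congrFun hsF i₀
    simp only [Pi.add_apply, Pi.smul_apply, Pi.single_eq_same, hF0, smul_eq_mul, mul_one] at h1
    intro h2
    refine hε ?_
    have h3 : F s i₀ = 1 / ((π i₀).1.factorial : ℝ) := h2
    rw [h3] at h1
    simpa using h1

/-! ### Sampling permutations from a measure on the plane -/

/-- The permutation induced by points of the plane with distinct first and distinct second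
coordinates: the inner sort lists the points by first coordinate, and the inverse of the outer one
gives the ranks of their second coordinates. -/
noncomputable def samplePerm {N : ℕ} (p : Fin N → ℝ × ℝ) : Equiv.Perm (Fin N) :=
  (Tuple.sort fun i => (p (Tuple.sort (fun j => (p j).1) i)).2)⁻¹

lemma samplePerm_lt_iff {N : ℕ} {p : Fin N → ℝ × ℝ}
    (hy : Function.Injective fun i => (p i).2) (i j : Fin N) :
    samplePerm p i < samplePerm p j ↔
      (p (Tuple.sort (fun j => (p j).1) i)).2 < (p (Tuple.sort (fun j => (p j).1) j)).2 := by
  set τ := Tuple.sort fun j => (p j).1 with hτ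
  set s := Tuple.sort fun i => (p (τ i)).2 with hs
  have hmono : StrictMono ((fun i => (p (τ i)).2) ∘ s) :=
    (Tuple.monotone_sort fun i => (p (τ i)).2).strictMono_of_injective
      ((hy.comp τ.injective).comp s.injective)
  change s.symm i < s.symm j ↔ _
  rw [← hmono.lt_iff_lt]
  simp

/-- The event that the points with indices in `A` induce `π`. -/
def InducesOn {N : ℕ} (π : Permutation) (A : Finset (Fin N)) (p : Fin N → ℝ × ℝ) : Prop :=
  ∃ h : A.card = π.1, Induces (fun i => p (A.orderEmbOfFin h i)) π.2

/-- A set of positions of the sampled permutation corresponds to a set of sample points. -/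
lemma inducesOn_map_sort_iff {N : ℕ} {p : Fin N → ℝ × ℝ}
    (hx : Function.Injective fun i => (p i).1) (hy : Function.Injective fun i => (p i).2)
    (π : Permutation) (A : Finset (Fin N)) :
    InducesOn π (A.map (Tuple.sort fun j => (p j).1).toEmbedding) p ↔
      ∃ h : A.card = π.1, ∀ i j : Fin π.1, π.2 i < π.2 j ↔
        samplePerm p (A.orderEmbOfFin h i) < samplePerm p (A.orderEmbOfFin h j) := by
  set τ := Tuple.sort fun j => (p j).1 with hτ
  set B := A.map τ.toEmbedding with hB
  have hτmono : StrictMono fun i => (p (τ i)).1 :=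
    (Tuple.monotone_sort fun i => (p i).1).strictMono_of_injective (hx.comp τ.injective)
  have hcard : B.card = A.card := Finset.card_map _
  unfold InducesOn
  simp only [hcard]
  refine exists_congr fun h => ?_
  have hBk : B.card = π.1 := hcard.trans h
  have hmem : ∀ i, τ (A.orderEmbOfFin h i) ∈ B := fun i =>
    Finset.mem_map_of_mem τ.toEmbedding (Finset.orderEmbOfFin_mem A h i)
  set f : Fin π.1 → Fin π.1 := fun i => (B.orderIsoOfFin hBk).symm ⟨_, hmem i⟩ with hf
  have hfB : ∀ i, B.orderEmbOfFin hBk (f i) = τ (A.orderEmbOfFin h i) := by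
    intro i
    rw [← Finset.coe_orderIsoOfFin_apply]
    simp [hf]
  have hfinj : Function.Injective f := by
    intro i j hij
    have h1 : τ (A.orderEmbOfFin h i) = τ (A.orderEmbOfFin h j) := by rw [← hfB, ← hfB, hij]
    exact (A.orderEmbOfFin h).injective (τ.injective h1)
  set σ : Equiv.Perm (Fin π.1) :=
    Equiv.ofBijective f (Finite.injective_iff_bijective.1 hfinj) with hσ
  have hσB : ∀ i, B.orderEmbOfFin hBk (σ i) = τ (A.orderEmbOfFin h i) := hfB
  have hmono : StrictMono fun i => (p (B.orderEmbOfFin hBk (σ i))).1 := by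
    simp only [hσB]
    exact hτmono.comp (A.orderEmbOfFin h).strictMono
  simp only [samplePerm_lt_iff hy, ← hτ, ← hσB]
  constructor
  · rintro ⟨ρ, hρ, hpat⟩
    have : ρ = σ := perm_eq_of_strictMono (u := fun i => (p (B.orderEmbOfFin hBk i)).1) hρ hmono
    rwa [this] at hpat
  · intro hpat
    exact ⟨σ, hmono, hpat⟩

/-- The proportion of the index sets that induce `π`, as a function of the sample points. -/
noncomputable def sampleDensity {N : ℕ} (π : Permutation) (p : Fin N → ℝ × ℝ) : ℝ :=
  (∑ A ∈ (Finset.univ : Finset (Fin N)).powersetCard π.1,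
    Set.indicator {p | InducesOn π A p} (fun _ => (1 : ℝ)) p) / (N.choose π.1 : ℝ)

open Classical in
lemma patternDensity_samplePerm {N : ℕ} {p : Fin N → ℝ × ℝ}
    (hx : Function.Injective fun i => (p i).1) (hy : Function.Injective fun i => (p i).2)
    (π : Permutation) :
    patternDensity π ⟨N, samplePerm p⟩ = sampleDensity π p := by
  unfold patternDensity sampleDensity
  congr 1
  simp only [Set.indicator_apply, Set.mem_ofPred_eq, Finset.sum_boole, Nat.cast_inj]
  set τ := Tuple.sort fun j => (p j).1 with hτ
  refine Finset.card_bij (fun A _ => A.map τ.toEmbedding) ?_ ?_ ?_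
  · intro A hA
    simp only [Finset.mem_filter, Finset.mem_powersetCard, Finset.subset_univ, true_and,
      Finset.card_map] at hA ⊢
    exact ⟨hA.1, (inducesOn_map_sort_iff hx hy π A).2 hA.2⟩
  · intro A _ B _ h
    exact Finset.map_injective _ h
  · intro B hB
    have hBB : (B.map τ.symm.toEmbedding).map τ.toEmbedding = B := by
      ext b; simp
    refine ⟨B.map τ.symm.toEmbedding, ?_, hBB⟩
    simp only [Finset.mem_filter, Finset.mem_powersetCard, Finset.subset_univ, true_and] at hB ⊢
    exact ⟨(Finset.card_map _).trans hB.1,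
      (inducesOn_map_sort_iff hx hy π _).1 (by rw [hBB]; exact hB.2)⟩

lemma setOf_inducesOn {N : ℕ} (π : Permutation) {A : Finset (Fin N)} (h : A.card = π.1) :
    {p | InducesOn π A p} = (fun (p : Fin N → ℝ × ℝ) i => p (A.orderEmbOfFin h i)) ⁻¹'
      {p | Induces p π.2} := by
  ext p
  exact ⟨fun ⟨_, h'⟩ => h', fun h' => ⟨h, h'⟩⟩

lemma measurableSet_inducesOn {N : ℕ} (π : Permutation) (A : Finset (Fin N)) :
    MeasurableSet {p | InducesOn π A p} := by
  by_cases h : A.card = π.1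
  · rw [setOf_inducesOn π h]
    exact (measurableSet_induces π.2).preimage (by fun_prop)
  · have : {p | InducesOn π A p} = ∅ := by
      ext p
      exact ⟨fun ⟨h', _⟩ => h h', False.elim⟩
    rw [this]
    exact MeasurableSet.empty

lemma measureReal_inducesOn {N : ℕ} (μ : Measure (ℝ × ℝ)) [IsProbabilityMeasure μ]
    (π : Permutation) {A : Finset (Fin N)} (h : A.card = π.1) :
    (Measure.pi fun _ : Fin N => μ).real {p | InducesOn π A p} = permutonDensity π μ := by
  rw [setOf_inducesOn π h, (measurePreserving_comp_injective μ
    (A.orderEmbOfFin h).injective).measureReal_preimage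
    (measurableSet_induces π.2).nullMeasurableSet]
  rfl

lemma memLp_indicator_inducesOn {N : ℕ} (μ : Measure (ℝ × ℝ)) [IsProbabilityMeasure μ]
    (π : Permutation) (A : Finset (Fin N)) :
    MemLp (Set.indicator {p | InducesOn π A p} fun _ => (1 : ℝ)) 2
      (Measure.pi fun _ : Fin N => μ) :=
  memLp_indicator_const 2 (measurableSet_inducesOn π A) 1 (Or.inr (measure_ne_top _ _))

lemma covariance_inducesOn_le_one {N : ℕ} (μ : Measure (ℝ × ℝ)) [IsProbabilityMeasure μ]
    (π : Permutation) (A B : Finset (Fin N)) :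
    cov[Set.indicator {p | InducesOn π A p} fun _ => (1 : ℝ),
      Set.indicator {p | InducesOn π B p} fun _ => (1 : ℝ);
      Measure.pi fun _ : Fin N => μ] ≤ 1 := by
  rw [covariance_eq_sub (memLp_indicator_inducesOn μ π A) (memLp_indicator_inducesOn μ π B)]
  have hA := measurableSet_inducesOn π A
  have hB := measurableSet_inducesOn π B
  have h1 : (Set.indicator {p | InducesOn π A p} fun _ => (1 : ℝ)) *
      (Set.indicator {p | InducesOn π B p} fun _ => (1 : ℝ)) =
      Set.indicator ({p | InducesOn π A p} ∩ {p | InducesOn π B p}) fun _ => (1 : ℝ) := by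
    ext p
    by_cases h2 : InducesOn π A p <;> by_cases h3 : InducesOn π B p <;> simp [h2, h3]
  rw [h1, integral_indicator_const _ (hA.inter hB), integral_indicator_const _ hA,
    integral_indicator_const _ hB]
  simp only [smul_eq_mul, mul_one]
  refine (sub_le_self _ (by positivity)).trans measureReal_le_one

/-- Events about disjoint sets of independent points are independent. -/
lemma covariance_inducesOn_eq_zero {N : ℕ} (μ : Measure (ℝ × ℝ)) [IsProbabilityMeasure μ]
    (π : Permutation) {A B : Finset (Fin N)} (hA : A.card = π.1) (hB : B.card = π.1)
    (hAB : Disjoint A B) :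
    cov[Set.indicator {p | InducesOn π A p} fun _ => (1 : ℝ),
      Set.indicator {p | InducesOn π B p} fun _ => (1 : ℝ);
      Measure.pi fun _ : Fin N => μ] = 0 := by
  refine IndepFun.covariance_eq_zero ?_ (memLp_indicator_inducesOn μ π A)
    (memLp_indicator_inducesOn μ π B)
  have h1 : iIndepFun (fun (i : Fin N) (ω : Fin N → ℝ × ℝ) => ω i)
      (Measure.pi fun _ : Fin N => μ) :=
    iIndepFun_pi (X := fun _ x => x) (fun _ => aemeasurable_id)
  have h2 := h1.indepFun_finset A B hAB fun i => measurable_pi_apply i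
  have hfun : ∀ {C : Finset (Fin N)} (hC : C.card = π.1),
      (Set.indicator {p | InducesOn π C p} fun _ => (1 : ℝ)) =
      (Set.indicator {q : C → ℝ × ℝ | Induces (fun i => q (C.orderIsoOfFin hC i)) π.2}
        fun _ => (1 : ℝ)) ∘ fun p i => p i := by
    intro C hC
    rw [setOf_inducesOn π hC]
    rfl
  have hmeas : ∀ {C : Finset (Fin N)} (hC : C.card = π.1), Measurable
      (Set.indicator {q : C → ℝ × ℝ | Induces (fun i => q (C.orderIsoOfFin hC i)) π.2}
        fun _ => (1 : ℝ)) := by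
    intro C hC
    refine measurable_const.indicator ?_
    exact (measurableSet_induces π.2).preimage
      (f := fun (q : C → ℝ × ℝ) i => q (C.orderIsoOfFin hC i)) (by fun_prop)
  rw [hfun hA, hfun hB]
  exact h2.comp (hmeas hA) (hmeas hB)

lemma memLp_sampleDensity {N : ℕ} (μ : Measure (ℝ × ℝ)) [IsProbabilityMeasure μ]
    (π : Permutation) :
    MemLp (fun p : Fin N → ℝ × ℝ => sampleDensity π p) 2 (Measure.pi fun _ : Fin N => μ) := by
  unfold sampleDensity
  simp only [div_eq_mul_inv]
  exact (memLp_finsetSum _ fun A _ => memLp_indicator_inducesOn μ π A).mul_const _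

lemma integral_sampleDensity {N : ℕ} (μ : Measure (ℝ × ℝ)) [IsProbabilityMeasure μ]
    (π : Permutation) (hN : π.1 ≤ N) :
    ∫ p : Fin N → ℝ × ℝ, sampleDensity π p ∂(Measure.pi fun _ => μ) = permutonDensity π μ := by
  have hM : ((N.choose π.1 : ℕ) : ℝ) ≠ 0 := by exact_mod_cast (Nat.choose_pos hN).ne'
  unfold sampleDensity
  rw [integral_div, integral_finsetSum _ fun A _ =>
    (memLp_indicator_inducesOn μ π A).integrable one_le_two]
  have h : ∀ A ∈ (Finset.univ : Finset (Fin N)).powersetCard π.1,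
      ∫ p, Set.indicator {p | InducesOn π A p} (fun _ => (1 : ℝ)) p
        ∂(Measure.pi fun _ : Fin N => μ) = permutonDensity π μ := by
    intro A hA
    rw [integral_indicator_const _ (measurableSet_inducesOn π A),
      measureReal_inducesOn μ π (Finset.mem_powersetCard.1 hA).2]
    simp
  rw [Finset.sum_congr rfl h, Finset.sum_const, Finset.card_powersetCard, Finset.card_univ,
    Fintype.card_fin, nsmul_eq_mul]
  field_simp

/-- The second moment bound: only pairs of intersecting index sets contribute to the variance. -/
lemma integral_sampleDensity_sub_sq_le {N : ℕ} (μ : Measure (ℝ × ℝ)) [IsProbabilityMeasure μ]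
    (π : Permutation) (hN : π.1 ≤ N) :
    ∫ p : Fin N → ℝ × ℝ, (sampleDensity π p - permutonDensity π μ) ^ 2
      ∂(Measure.pi fun _ => μ) ≤ 1 - ((N - π.1).choose π.1 : ℝ) / (N.choose π.1 : ℝ) := by
  set P := Measure.pi fun _ : Fin N => μ
  have hM : (0 : ℝ) < (N.choose π.1 : ℕ) := by exact_mod_cast Nat.choose_pos hN
  rw [← integral_sampleDensity μ π hN, ← variance_eq_integral
    (memLp_sampleDensity μ π).aestronglyMeasurable.aemeasurable]
  unfold sampleDensity
  simp only [div_eq_mul_inv _ ((N.choose π.1 : ℕ) : ℝ)]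
  rw [variance_mul_const, variance_fun_sum' fun A _ => memLp_indicator_inducesOn μ π A]
  have hinner : ∀ A ∈ (Finset.univ : Finset (Fin N)).powersetCard π.1,
      ∑ B ∈ (Finset.univ : Finset (Fin N)).powersetCard π.1,
        cov[Set.indicator {p | InducesOn π A p} fun _ => (1 : ℝ),
          Set.indicator {p | InducesOn π B p} fun _ => (1 : ℝ); P] ≤
      (N.choose π.1 : ℝ) - ((N - π.1).choose π.1 : ℝ) := by
    intro A hA
    have hA' := (Finset.mem_powersetCard.1 hA).2
    calc _ ≤ ∑ B ∈ (Finset.univ : Finset (Fin N)).powersetCard π.1,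
          (1 - if Disjoint A B then (1 : ℝ) else 0) := by
          refine Finset.sum_le_sum fun B hB => ?_
          split_ifs with hAB
          · rw [covariance_inducesOn_eq_zero μ π hA' (Finset.mem_powersetCard.1 hB).2 hAB]
            simp
          · simpa using covariance_inducesOn_le_one μ π A B
      _ = _ := by
          have hdisj : ((Finset.univ : Finset (Fin N)).powersetCard π.1).filter
              (fun B => Disjoint A B) = Aᶜ.powersetCard π.1 := by
            ext B
            simp only [Finset.mem_filter, Finset.mem_powersetCard, Finset.subset_univ, true_and,
              ← le_compl_iff_disjoint_left]
            exact and_comm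
          rw [Finset.sum_sub_distrib, Finset.sum_boole, hdisj]
          simp [Finset.card_compl, hA']
  refine (mul_le_mul_of_nonneg_right (Finset.sum_le_sum hinner) (by positivity)).trans
    (le_of_eq ?_)
  rw [Finset.sum_const, Finset.card_powersetCard, Finset.card_univ, Fintype.card_fin,
    nsmul_eq_mul]
  field_simp

lemma tendsto_choose_sub_div_choose (k : ℕ) :
    Tendsto (fun N : ℕ => 1 - ((N - k).choose k : ℝ) / (N.choose k : ℝ)) atTop (𝓝 0) := by
  have h1 := isEquivalent_choose k
  have h2 := h1.comp_tendsto (tendsto_sub_atTop_nat k)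
  have h3 := h2.div h1
  have hr : Tendsto (fun N : ℕ => ((N - k : ℕ) : ℝ) / N) atTop (𝓝 1) := by
    have h4 : Tendsto (fun N : ℕ => 1 - (k : ℝ) / N) atTop (𝓝 (1 - 0)) :=
      tendsto_const_nhds.sub (tendsto_const_div_atTop_nhds_zero_nat (k : ℝ))
    rw [sub_zero] at h4
    refine h4.congr' ?_
    filter_upwards [eventually_ge_atTop k, eventually_gt_atTop 0] with N hN h0
    have : (N : ℝ) ≠ 0 := by positivity
    rw [Nat.cast_sub hN]
    field_simp
  have h5 : Tendsto (fun N : ℕ => ((N - k).choose k : ℝ) / (N.choose k : ℝ)) atTop (𝓝 1) := by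
    refine h3.symm.tendsto_nhds ?_
    have h6 := hr.pow k
    rw [one_pow] at h6
    refine h6.congr' ?_
    filter_upwards [eventually_gt_atTop 0] with N h0
    have : (N : ℝ) ≠ 0 := by positivity
    have hk : (k.factorial : ℝ) ≠ 0 := by positivity
    simp only [Pi.div_apply, Function.comp, div_pow]
    field_simp
  simpa using h5.const_sub 1

/-- Some sample attains at most the mean squared deviation, summed over a finite set of patterns. -/
lemma exists_perm_sum_sq_le (μ : Measure (ℝ × ℝ)) [IsProbabilityMeasure μ]
    (hx : ∀ a : ℝ, μ {p | p.1 = a} = 0) (hy : ∀ a : ℝ, μ {p | p.2 = a} = 0)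
    (T : Finset Permutation) {N : ℕ} (hN : ∀ π ∈ T, π.1 ≤ N) :
    ∃ Q : Equiv.Perm (Fin N), ∑ π ∈ T, (patternDensity π ⟨N, Q⟩ - permutonDensity π μ) ^ 2 ≤
      ∑ π ∈ T, (1 - ((N - π.1).choose π.1 : ℝ) / (N.choose π.1 : ℝ)) := by
  have hint : ∀ π ∈ T, Integrable (fun p : Fin N → ℝ × ℝ =>
      (sampleDensity π p - permutonDensity π μ) ^ 2) (Measure.pi fun _ => μ) := fun π _ =>
    ((memLp_sampleDensity μ π).sub (memLp_const _)).integrable_sq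
  have hnull : (Measure.pi fun _ : Fin N => μ) {p | ¬ (Function.Injective (fun i => (p i).1) ∧
      Function.Injective fun i => (p i).2)} = 0 :=
    ae_iff.1 ((ae_injective_comp μ measurable_fst hx).and (ae_injective_comp μ measurable_snd hy))
  obtain ⟨p, hp, hle⟩ := exists_notMem_null_le_integral (integrable_finsetSum T hint) hnull
  simp only [Set.mem_ofPred_eq, not_not] at hp
  refine ⟨samplePerm p, ?_⟩
  simp only [patternDensity_samplePerm hp.1 hp.2]
  refine hle.trans ?_
  rw [integral_finsetSum T hint]
  exact Finset.sum_le_sum fun π hπ => integral_sampleDensity_sub_sq_le μ π (hN π hπ)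

lemma exists_seq_tendsto_permutonDensity (μ : Measure (ℝ × ℝ)) [IsProbabilityMeasure μ]
    (hx : ∀ a : ℝ, μ {p | p.1 = a} = 0) (hy : ∀ a : ℝ, μ {p | p.2 = a} = 0)
    (T : Finset Permutation) :
    ∃ Q : ℕ → Permutation, (∀ N, (Q N).1 = N) ∧
      ∀ π ∈ T, Tendsto (fun N => patternDensity π (Q N)) atTop (𝓝 (permutonDensity π μ)) := by
  have hex : ∀ N : ℕ, ∃ Q : Equiv.Perm (Fin N), (∀ π ∈ T, π.1 ≤ N) →
      ∑ π ∈ T, (patternDensity π ⟨N, Q⟩ - permutonDensity π μ) ^ 2 ≤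
        ∑ π ∈ T, (1 - ((N - π.1).choose π.1 : ℝ) / (N.choose π.1 : ℝ)) := by
    intro N
    by_cases h : ∀ π ∈ T, π.1 ≤ N
    · obtain ⟨Q, hQ⟩ := exists_perm_sum_sq_le μ hx hy T h
      exact ⟨Q, fun _ => hQ⟩
    · exact ⟨1, fun h' => absurd h' h⟩
  choose Q hQ using hex
  refine ⟨fun N => ⟨N, Q N⟩, fun _ => rfl, fun π hπ => ?_⟩
  have hlim : Tendsto (fun N : ℕ => ∑ π ∈ T,
      (1 - ((N - π.1).choose π.1 : ℝ) / (N.choose π.1 : ℝ))) atTop (𝓝 0) := by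
    simpa using tendsto_finsetSum T fun π _ => tendsto_choose_sub_div_choose π.1
  have hsq : Tendsto (fun N : ℕ => (patternDensity π ⟨N, Q N⟩ - permutonDensity π μ) ^ 2)
      atTop (𝓝 0) := by
    refine tendsto_of_tendsto_of_tendsto_of_le_of_le' tendsto_const_nhds hlim
      (Eventually.of_forall fun N => sq_nonneg _) ?_
    filter_upwards [eventually_ge_atTop (T.sup fun π => π.1)] with N hN
    refine le_trans ?_ (hQ N fun π hπ => (Finset.le_sup (f := fun π => π.1) hπ).trans hN)
    exact Finset.single_le_sum
      (f := fun π => (patternDensity π ⟨N, Q N⟩ - permutonDensity π μ) ^ 2)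
      (fun _ _ => sq_nonneg _) hπ
  have h0 : Tendsto (fun N : ℕ => patternDensity π ⟨N, Q N⟩ - permutonDensity π μ)
      atTop (𝓝 0) := by
    have h1 := hsq.sqrt
    simp only [Real.sqrt_sq_eq_abs, Real.sqrt_zero] at h1
    exact (tendsto_zero_iff_abs_tendsto_zero _).2 h1
  simpa using h0.add_const (permutonDensity π μ)

/-! ### Step permutons as probability measures -/

lemma stepPermuton_apply_eq_zero {n : ℕ} (M : Matrix (Fin n) (Fin n) ℝ) {s : Set (ℝ × ℝ)}
    (hs : (volume : Measure (ℝ × ℝ)) s = 0) : stepPermuton M s = 0 := by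
  simp only [stepPermuton, Measure.finsetSum_apply, Measure.smul_apply, smul_eq_mul]
  refine Finset.sum_eq_zero fun i _ => Finset.sum_eq_zero fun j _ => ?_
  exact mul_eq_zero_of_right _
    (le_antisymm ((Measure.le_iff'.1 Measure.restrict_le_self s).trans_eq hs) bot_le)

lemma volume_fst_eq (a : ℝ) : (volume : Measure (ℝ × ℝ)) {p | p.1 = a} = 0 := by
  have : {p : ℝ × ℝ | p.1 = a} = {a} ×ˢ Set.univ := by ext; simp
  rw [this, Measure.volume_eq_prod, Measure.prod_prod]
  simp

lemma volume_snd_eq (a : ℝ) : (volume : Measure (ℝ × ℝ)) {p | p.2 = a} = 0 := by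
  have : {p : ℝ × ℝ | p.2 = a} = Set.univ ×ˢ {a} := by ext; simp
  rw [this, Measure.volume_eq_prod, Measure.prod_prod]
  simp

lemma sum_perturbedMatrix {n : ℕ} (hn : 0 < n) (x : Matrix (Fin (n - 1)) (Fin (n - 1)) ℝ) :
    ∑ t : Fin n × Fin n, perturbedMatrix n x t.1 t.2 = n := by
  have hn' : (n : ℝ) ≠ 0 := by positivity
  simp only [perturbedMatrix_apply, Finset.sum_add_distrib]
  have h : ∑ t : Fin n × Fin n, ∑ k, ∑ l, x k l * perturbation n k l t.1 t.2 = 0 := by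
    rw [Finset.sum_comm]
    refine Finset.sum_eq_zero fun k _ => ?_
    rw [Finset.sum_comm]
    refine Finset.sum_eq_zero fun l _ => ?_
    simp only [perturbation_apply]
    rw [← Finset.mul_sum, Fintype.sum_prod_type, ← Finset.sum_mul_sum]
    have h1 := sum_stepDiff_mul (a := k.val + 1) (n := n)
      ⟨by omega, by have := k.isLt; omega⟩ fun _ => 1
    simp only [mul_one, sub_self] at h1
    rw [h1, zero_mul, mul_zero]
  rw [h]
  simp

lemma isProbabilityMeasure_stepPermuton {n : ℕ} (hn : 0 < n)
    (x : Matrix (Fin (n - 1)) (Fin (n - 1)) ℝ) (hx : ∀ i j, 0 ≤ perturbedMatrix n x i j) :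
    IsProbabilityMeasure (stepPermuton (perturbedMatrix n x)) := by
  have hn' : (0 : ℝ) < n := by exact_mod_cast hn
  constructor
  have hcell : ∀ t : Fin n, cellMeasure n t Set.univ = ENNReal.ofReal (1 / n) := by
    intro t
    rw [cellMeasure, Measure.restrict_apply_univ, Real.volume_Ioc]
    congr 1
    ring
  rw [stepPermuton_eq_sum_prod]
  simp only [Measure.finsetSum_apply, Measure.smul_apply, smul_eq_mul]
  have hterm : ∀ t : Fin n × Fin n, ENNReal.ofReal (n * perturbedMatrix n x t.1 t.2) *
      (cellMeasure n t.1).prod (cellMeasure n t.2) Set.univ =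
      ENNReal.ofReal (perturbedMatrix n x t.1 t.2 / n) := by
    intro t
    rw [← Set.univ_prod_univ, Measure.prod_prod, hcell, hcell,
      ← ENNReal.ofReal_mul (by positivity), ← ENNReal.ofReal_mul (mul_nonneg hn'.le (hx _ _))]
    congr 1
    field_simp
  rw [Finset.sum_congr rfl fun t _ => hterm t,
    ← ENNReal.ofReal_sum_of_nonneg fun t _ => div_nonneg (hx _ _) hn'.le, ← Finset.sum_div,
    sum_perturbedMatrix hn x, div_self hn'.ne', ENNReal.ofReal_one]

/-! ### Finite sets that are not forcing -/

lemma not_isForcing_of_linearIndependent (S : Finset Permutation)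
    (hS : LinearIndependent ℝ fun π : S => explicitGradient (π : Permutation)) :
    ¬ IsForcing (S : Set Permutation) := by
  classical
  obtain ⟨π₀, hπ₀⟩ := exists_explicitGradient_notMem_span S
  have hmem : π₀ ∉ S := fun h => hπ₀ (Submodule.subset_span ⟨π₀, h, rfl⟩)
  have hS' : LinearIndepOn ℝ explicitGradient (S : Set Permutation) := hS
  have hT : LinearIndepOn ℝ explicitGradient
      ((insert π₀ S : Finset Permutation) : Set Permutation) := by
    rw [Finset.coe_insert]
    exact hS'.insert hπ₀
  obtain ⟨n, hn, x, hx, heq, hne⟩ := exists_matrix_density_ne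
    (fun π : (insert π₀ S : Finset Permutation) => (π : Permutation)) hT
    ⟨π₀, Finset.mem_insert_self _ _⟩
  have := isProbabilityMeasure_stepPermuton hn x hx
  obtain ⟨Q, hQN, hQ⟩ := exists_seq_tendsto_permutonDensity (stepPermuton (perturbedMatrix n x))
    (fun a => stepPermuton_apply_eq_zero _ (volume_fst_eq a))
    (fun a => stepPermuton_apply_eq_zero _ (volume_snd_eq a)) (insert π₀ S)
  intro hforce
  have hquasi := hforce Q (by simp only [hQN]; exact tendsto_id) fun π hπ => by
    have hπT : π ∈ insert π₀ S := Finset.mem_insert_of_mem hπ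
    have h1 := heq ⟨π, hπT⟩ fun h => hmem (by
      obtain rfl : π = π₀ := Subtype.ext_iff.1 h
      exact hπ)
    have h2 := hQ π hπT
    rw [show permutonDensity π (stepPermuton (perturbedMatrix n x)) =
      1 / (π.1.factorial : ℝ) from h1] at h2
    exact h2
  exact hne (tendsto_nhds_unique (hQ π₀ (Finset.mem_insert_self _ _)) (hquasi π₀))

end PermForcing

theorem mainTheorem2 (S : Finset PermForcing.Permutation) (hS : S.Nonempty) :
    (∀ π ∈ S, ∃! P : MvPolynomial (Fin 2) ℝ, PermForcing.IsGradientPolynomial π P) ∧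
    (LinearIndependent ℝ (fun π : S => PermForcing.gradientPolynomial (π : PermForcing.Permutation)) →
      ¬ PermForcing.IsForcing (S : Set PermForcing.Permutation)) := by
  refine ⟨fun π _ => ⟨_, PermForcing.isGradientPolynomial_explicitGradient π,
    fun P hP => hP.unique (PermForcing.isGradientPolynomial_explicitGradient π)⟩, fun h => ?_⟩
  simp only [PermForcing.gradientPolynomial_eq] at h
  exact PermForcing.not_isForcing_of_linearIndependent S h
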